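/- Let $(U_t)_{t\in\mathbf R}$ be a strongly continuous orthogonal representation of $\mathbf R$ on a real Hilbert space $H_{\mathbf R}$. Extend it to a unitary representation on the complexification $H_{\mathbf C}$, write $U_t=A^{it}$ with $A$ positive, self-adjoint and injective, and let $H$ be the completion of $H_{\mathbf C}$ for the inner product $\langle\xi,\eta\rangle_U=\langle \frac{2}{1+A^{-1}}\xi,\eta\rangle$; $(U_t)$ still acts unitarily on $H$. On the full Fock space $\mathcal F(H)=\mathbf C\Omega\oplus\bigoplus_{n\ge 1}H^{\otimes n}$ let $\ell(\xi)$ be the left creation operators and $s(\xi)=\frac12(\ell(\xi)+\ell(\xi)^*)$. Let $\mathcal M=\Gamma(H_{\mathbf R},U_t)''=\{s(\xi):\xi\in H_{\mathbf R}\}''$ be the associated free Araki--Woods von Neumann algebra, $\varphi_U=\langle\,\cdot\,\Omega,\Omega\rangle_U$ the free quasi-free state on $\mathcal M$, and $\sigma_t^{\varphi_U}=\mathrm{Ad}(\mathcal F(U_{-t}))|_{\mathcal M}$ where $\mathcal F(U_t)=\bigoplus_{n\ge 0}U_t^{\otimes n}$. Then $\varphi_U$ is faithful; $(\sigma_t^{\varphi_U})$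 is the modular group of $\varphi_U$, i.e. it is a strongly continuous one-parameter group of $*$-automorphisms of $\mathcal M$ which preserves $\varphi_U$ and such that for all $x,y\in\mathcal M$ there is a bounded continuous function $F$ on $\{0\le\operatorname{Im} z\le 1\}$, holomorphic in the interior, with $F(t)=\varphi_U(\sigma_t^{\varphi_U}(x)y)$ and $F(t+i)=\varphi_U(y\,\sigma_t^{\varphi_U}(x))$ for all $t\in\mathbf R$; and the following are equivalent: 1. $(U_t)$ is mixing: $\langle U_t\xi,\eta\rangle\to 0$ as $|t|\to\infty$ for all $\xi,\eta\in H_{\mathbf R}$; 2. $(\sigma_t^{\varphi_U})$ is $\varphi_U$-mixing: $\varphi_U(\sigma_t^{\varphi_U}(x)y)\to 0$ as $|t|\to\infty$ for all $x,y\in\mathcal M$ with $\varphi_U(x)=\varphi_U(y)=0$. -/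

import Mathlib

set_option linter.unusedSectionVars false

namespace FreeArakiWoods

open Complex Filter Topology
open scoped ComplexConjugate

/-- A strongly continuous one-parameter group `(V_t)` of linear isometries of `E` (so each `V_t` is
invertible with inverse `V_{-t}`): a strongly continuous orthogonal (`𝕜 = ℝ`) or unitary (`𝕜 = ℂ`)
representation of `ℝ` on `E`. -/
structure IsometricRep (𝕜 E : Type*) [RCLike 𝕜] [SeminormedAddCommGroup E]
    [InnerProductSpace 𝕜 E] where
  toFun : ℝ → E →ₗᵢ[𝕜] E
  map_zero' : toFun 0 = LinearIsometry.id
  map_add' : ∀ s t, toFun (s + t) = (toFun s).comp (toFun t)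
  continuous' : ∀ x, Continuous fun t => toFun t x

instance (𝕜 E : Type*) [RCLike 𝕜] [SeminormedAddCommGroup E] [InnerProductSpace 𝕜 E] :
    CoeFun (IsometricRep 𝕜 E) (fun _ => ℝ → E →ₗᵢ[𝕜] E) := ⟨IsometricRep.toFun⟩

namespace IsometricRep

variable {𝕜 E : Type*} [RCLike 𝕜] [SeminormedAddCommGroup E] [InnerProductSpace 𝕜 E]

theorem zero_apply (V : IsometricRep 𝕜 E) (x : E) : V 0 x = x := by simp [V.map_zero']

theorem add_apply (V : IsometricRep 𝕜 E) (s t : ℝ) (x : E) : V (s + t) x = V s (V t x) := by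
  simp [V.map_add']

theorem neg_apply_self (V : IsometricRep 𝕜 E) (t : ℝ) (x : E) : V (-t) (V t x) = x := by
  rw [← V.add_apply, neg_add_cancel, V.zero_apply]

theorem apply_neg_self (V : IsometricRep 𝕜 E) (t : ℝ) (x : E) : V t (V (-t) x) = x := by
  rw [← V.add_apply, add_neg_cancel, V.zero_apply]

theorem inner_apply_left (V : IsometricRep 𝕜 E) (t : ℝ) (x y : E) :
    inner 𝕜 (V t x) y = inner 𝕜 x (V (-t) y) := by
  rw [← (V t).inner_map_map x, V.apply_neg_self]

/-- Mixing: all matrix coefficients vanish at infinity. -/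
def IsMixing (V : IsometricRep 𝕜 E) : Prop :=
  ∀ x y : E, Tendsto (fun t => inner 𝕜 (V t x) y) (cocompact ℝ) (𝓝 0)

/-- The extension of a representation to the Hilbert space completion. -/
noncomputable def completion (V : IsometricRep 𝕜 E) :
    IsometricRep 𝕜 (UniformSpace.Completion E) where
  toFun t :=
    { (V t).toContinuousLinearMap.completion with
      norm_map' := fun x => by
        induction x using UniformSpace.Completion.induction_on with
        | hp =>
          exact isClosed_eq ((V t).toContinuousLinearMap.completion.continuous.norm)
            continuous_norm
        | ih x =>
          change ‖(V t).toContinuousLinearMap.completion x‖ = _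
          simp }
  map_zero' := by
    ext x
    change (V 0).toContinuousLinearMap.completion x = x
    induction x using UniformSpace.Completion.induction_on with
    | hp => exact isClosed_eq (ContinuousLinearMap.continuous _) continuous_id
    | ih x => simp [V.zero_apply]
  map_add' s t := by
    ext x
    change (V (s + t)).toContinuousLinearMap.completion x =
      (V s).toContinuousLinearMap.completion ((V t).toContinuousLinearMap.completion x)
    induction x using UniformSpace.Completion.induction_on with
    | hp =>
      exact isClosed_eq (ContinuousLinearMap.continuous _)
        ((ContinuousLinearMap.continuous _).comp (ContinuousLinearMap.continuous _))
    | ih x => simp [V.add_apply]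
  continuous' x := by
    change Continuous fun t => (V t).toContinuousLinearMap.completion x
    have hiso : ∀ t (y z : UniformSpace.Completion E),
        dist ((V t).toContinuousLinearMap.completion y)
          ((V t).toContinuousLinearMap.completion z) = dist y z := by
      intro t y z
      rw [dist_eq_norm, dist_eq_norm, ← map_sub]
      induction (y - z) using UniformSpace.Completion.induction_on with
      | hp =>
        exact isClosed_eq ((V t).toContinuousLinearMap.completion.continuous.norm)
          continuous_norm
      | ih x => simp
    refine Metric.continuous_iff.2 fun t ε hε => ?_
    obtain ⟨y, hy⟩ := Metric.denseRange_iff.1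
      (UniformSpace.Completion.denseRange_coe (α := E)) x (ε / 3) (by positivity)
    obtain ⟨δ, hδ, h⟩ := Metric.continuous_iff.1 (V.continuous' y) t (ε / 3) (by positivity)
    refine ⟨δ, hδ, fun s hs => ?_⟩
    have h1 := hiso s x y
    have h2 := hiso t y x
    have h3 : dist ((V s).toContinuousLinearMap.completion (y : UniformSpace.Completion E))
        ((V t).toContinuousLinearMap.completion (y : UniformSpace.Completion E)) < ε / 3 := by
      simpa using h s hs
    rw [dist_comm (y : UniformSpace.Completion E) x] at h2
    have h4 := dist_triangle4 ((V s).toContinuousLinearMap.completion x)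
      ((V s).toContinuousLinearMap.completion (y : UniformSpace.Completion E))
      ((V t).toContinuousLinearMap.completion (y : UniformSpace.Completion E))
      ((V t).toContinuousLinearMap.completion x)
    linarith

end IsometricRep

/-! ### Complexification -/

/-- The complexified Hilbert space `H_ℂ = H_ℝ ⊗ ℂ`; the pair `(x, y)` stands for `x + i y`. -/
def Complexification (H : Type*) : Type _ := WithLp 2 (H × H)

namespace Complexification

variable {H : Type*} [NormedAddCommGroup H] [InnerProductSpace ℝ H]

noncomputable instance : NormedAddCommGroup (Complexification H) :=
  inferInstanceAs (NormedAddCommGroup (WithLp 2 (H × H)))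

instance [CompleteSpace H] : CompleteSpace (Complexification H) :=
  inferInstanceAs (CompleteSpace (WithLp 2 (H × H)))

/-- The vector `x + i y`. -/
def mk (x y : H) : Complexification H := WithLp.toLp 2 (x, y)

/-- Real part. -/
def re (z : Complexification H) : H := WithLp.fst z

/-- Imaginary part. -/
def im (z : Complexification H) : H := WithLp.snd z

@[ext] theorem ext {z w : Complexification H} (h1 : z.re = w.re) (h2 : z.im = w.im) : z = w :=
  WithLp.ofLp_injective 2 (Prod.ext h1 h2)

@[simp] theorem re_mk (x y : H) : (mk x y).re = x := rfl
@[simp] theorem im_mk (x y : H) : (mk x y).im = y := rfl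
@[simp] theorem re_add (z w : Complexification H) : (z + w).re = z.re + w.re := rfl
@[simp] theorem im_add (z w : Complexification H) : (z + w).im = z.im + w.im := rfl
@[simp] theorem re_zero : (0 : Complexification H).re = 0 := rfl
@[simp] theorem im_zero : (0 : Complexification H).im = 0 := rfl

theorem norm_sq (z : Complexification H) : ‖z‖ ^ 2 = ‖z.re‖ ^ 2 + ‖z.im‖ ^ 2 :=
  WithLp.prod_norm_sq_eq_of_L2 _

noncomputable instance : SMul ℂ (Complexification H) :=
  ⟨fun c z => mk (c.re • z.re - c.im • z.im) (c.re • z.im + c.im • z.re)⟩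

@[simp] theorem re_smul (c : ℂ) (z : Complexification H) :
    (c • z).re = c.re • z.re - c.im • z.im := rfl
@[simp] theorem im_smul (c : ℂ) (z : Complexification H) :
    (c • z).im = c.re • z.im + c.im • z.re := rfl

noncomputable instance : Module ℂ (Complexification H) where
  one_smul z := by ext <;> simp
  mul_smul a b z := by ext <;> simp <;> module
  smul_zero a := by ext <;> simp
  smul_add a z w := by ext <;> simp <;> module
  add_smul a b z := by ext <;> simp <;> module
  zero_smul z := by ext <;> simp

/-- The sesquilinear extension of the real inner product, conjugate linear in the first
variable. -/
noncomputable instance : InnerProductSpace ℂ (Complexification H) where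
  norm_smul_le c z := by
    refine le_of_eq ?_
    rw [← sq_eq_sq₀ (norm_nonneg _) (by positivity), mul_pow, norm_sq, norm_sq, re_smul, im_smul,
      norm_sub_sq_real, norm_add_sq_real, Complex.sq_norm, Complex.normSq_apply]
    simp only [norm_smul, inner_smul_left, inner_smul_right, mul_pow, Real.norm_eq_abs, sq_abs,
      real_inner_comm z.re z.im]
    simp
    ring
  inner z w := ⟨inner ℝ z.re w.re + inner ℝ z.im w.im, inner ℝ z.re w.im - inner ℝ z.im w.re⟩
  norm_sq_eq_re_inner z := by
    simp [norm_sq]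
  conj_inner_symm z w := by
    apply Complex.ext
    · simp [real_inner_comm]
    · simp [real_inner_comm]
  add_left x y z := by
    apply Complex.ext <;> simp [inner_add_left] <;> ring
  smul_left x y c := by
    apply Complex.ext <;> simp [inner_add_left, inner_sub_left, inner_smul_left] <;> ring

theorem inner_def (z w : Complexification H) : inner ℂ z w =
    ⟨inner ℝ z.re w.re + inner ℝ z.im w.im, inner ℝ z.re w.im - inner ℝ z.im w.re⟩ := rfl

end Complexification

/-- The unitary representation on `H_ℂ` obtained from an orthogonal representation on `H_ℝ`. -/
noncomputable def IsometricRep.complexify {H : Type*} [NormedAddCommGroup H]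
    [InnerProductSpace ℝ H] (U : IsometricRep ℝ H) : IsometricRep ℂ (Complexification H) where
  toFun t :=
    { toFun := fun z => .mk (U t z.re) (U t z.im)
      map_add' := fun z w => by ext <;> simp
      map_smul' := fun c z => by ext <;> simp
      norm_map' := fun z => by
        change ‖Complexification.mk (U t z.re) (U t z.im)‖ = ‖z‖
        rw [← sq_eq_sq₀ (norm_nonneg _) (norm_nonneg _)]
        simp [Complexification.norm_sq] }
  map_zero' := by
    ext z
    · exact U.zero_apply _
    · exact U.zero_apply _
  map_add' s t := by
    ext z
    · exact U.add_apply _ _ _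
    · exact U.add_apply _ _ _
  continuous' z := by
    change Continuous fun t => WithLp.toLp 2 (U t z.re, U t z.im)
    exact (WithLp.prod_continuous_toLp 2 H H).comp
      ((U.continuous' _).prodMk (U.continuous' _))

/-! ### The positive generator -/

section Generator

variable {K : Type*} [NormedAddCommGroup K] [InnerProductSpace ℂ K]

/-- `F` is bounded and continuous on the closed strip `a ≤ Im z ≤ b` and holomorphic in its
interior. -/
def IsStripAnalytic (a b : ℝ) (F : ℂ → K) : Prop :=
  ContinuousOn F (im ⁻¹' Set.Icc a b) ∧ DifferentiableOn ℂ F (im ⁻¹' Set.Ioo a b) ∧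
    ∃ C, ∀ z ∈ im ⁻¹' Set.Icc a b, ‖F z‖ ≤ C

namespace IsStripAnalytic

variable {a b : ℝ} {F G : ℂ → K}

theorem zero (a b : ℝ) : IsStripAnalytic a b (0 : ℂ → K) :=
  ⟨continuousOn_const, differentiableOn_const _, 0, by simp⟩

theorem add (hF : IsStripAnalytic a b F) (hG : IsStripAnalytic a b G) :
    IsStripAnalytic a b (F + G) := by
  obtain ⟨h1, h2, C, h3⟩ := hF
  obtain ⟨k1, k2, D, k3⟩ := hG
  exact ⟨h1.add k1, h2.add k2, C + D, fun z hz => (norm_add_le _ _).trans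
    (add_le_add (h3 z hz) (k3 z hz))⟩

theorem clm_comp {L : Type*} [NormedAddCommGroup L] [InnerProductSpace ℂ L]
    (T : K →L[ℂ] L) (hF : IsStripAnalytic a b F) :
    IsStripAnalytic a b (fun z => T (F z)) := by
  obtain ⟨h1, h2, C, h3⟩ := hF
  exact ⟨T.continuous.comp_continuousOn h1, T.differentiable.comp_differentiableOn h2,
    ‖T‖ * C, fun z hz => (T.le_opNorm _).trans
      (mul_le_mul_of_nonneg_left (h3 z hz) (norm_nonneg _))⟩

theorem sub (hF : IsStripAnalytic a b F) (hG : IsStripAnalytic a b G) :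
    IsStripAnalytic a b (F - G) := by
  obtain ⟨h1, h2, C, h3⟩ := hF
  obtain ⟨k1, k2, D, k3⟩ := hG
  exact ⟨h1.sub k1, h2.sub k2, C + D, fun z hz => (norm_sub_le _ _).trans
    (add_le_add (h3 z hz) (k3 z hz))⟩

/-- A strip-analytic function is determined by its values on the real axis. -/
theorem eq_zero (hb : 0 < b) (hF : IsStripAnalytic (-b) 0 F) (h0 : ∀ t : ℝ, F t = 0)
    {z : ℂ} (hz : z ∈ im ⁻¹' Set.Icc (-b) 0) : F z = 0 := by
  obtain ⟨h1, h2, C, h3⟩ := hF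
  let m : ℂ → ℂ := fun w => -(I * b * w)
  have him : ∀ w : ℂ, (m w).im = -(b * w.re) := fun w => by simp [m]
  have hd : DifferentiableOn ℂ m Set.univ := by fun_prop
  have hmap : Set.MapsTo m (HadamardThreeLines.verticalStrip 0 1) (im ⁻¹' Set.Ioo (-b) 0) := by
    intro w hw
    simp only [HadamardThreeLines.verticalStrip, Set.mem_preimage, Set.mem_Ioo, him] at hw ⊢
    constructor <;> nlinarith
  have hmapc : Set.MapsTo m (HadamardThreeLines.verticalClosedStrip 0 1)
      (im ⁻¹' Set.Icc (-b) 0) := by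
    intro w hw
    simp only [HadamardThreeLines.verticalClosedStrip, Set.mem_preimage, Set.mem_Icc, him] at hw ⊢
    constructor <;> nlinarith
  have hcl : closure (HadamardThreeLines.verticalStrip 0 1)
      = HadamardThreeLines.verticalClosedStrip 0 1 := by
    rw [HadamardThreeLines.verticalStrip, HadamardThreeLines.verticalClosedStrip,
      closure_preimage_re, closure_Ioo zero_ne_one]
  have hg : DiffContOnCl ℂ (F ∘ m) (HadamardThreeLines.verticalStrip 0 1) := by
    refine ⟨h2.comp (hd.mono (Set.subset_univ _)) hmap, ?_⟩
    rw [hcl]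
    exact h1.comp (hd.continuousOn.mono (Set.subset_univ _)) hmapc
  have hB : BddAbove ((norm ∘ (F ∘ m)) '' HadamardThreeLines.verticalClosedStrip 0 1) := by
    refine ⟨C, ?_⟩
    rintro _ ⟨w, hw, rfl⟩
    exact h3 _ (hmapc hw)
  have hb' : (b : ℂ) ≠ 0 := by exact_mod_cast hb.ne'
  have hmz : m (I * z / b) = z := by
    simp only [m]
    field_simp
    simp
  have hw : I * z / b ∈ HadamardThreeLines.verticalClosedStrip 0 1 := by
    have h := him (I * z / b)
    rw [hmz] at h
    simp only [Set.mem_preimage, Set.mem_Icc] at hz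
    simp only [HadamardThreeLines.verticalClosedStrip, Set.mem_preimage, Set.mem_Icc]
    constructor <;> nlinarith
  have hs : HadamardThreeLines.sSupNormIm (F ∘ m) 0 = 0 := by
    have : (norm ∘ (F ∘ m)) '' (re ⁻¹' {0}) ⊆ {0} := by
      rintro _ ⟨w, hw, rfl⟩
      simp only [Set.mem_preimage, Set.mem_singleton_iff] at hw
      have hmw : m w = ((b * w.im : ℝ) : ℂ) := by
        apply Complex.ext <;> simp [m, hw]
      simp [hmw, h0 (b * w.im), -ofReal_mul]
    rw [HadamardThreeLines.sSupNormIm]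
    rcases Set.subset_singleton_iff_eq.1 this with h | h <;> rw [h] <;> simp
  have key := HadamardThreeLines.norm_le_interpStrip_of_mem_verticalClosedStrip₀₁ (F ∘ m) hw hg hB
  rw [HadamardThreeLines.interpStrip_eq_of_zero _ _ (Or.inl hs), norm_zero,
    Function.comp_apply, hmz] at key
  exact norm_le_zero_iff.1 key

end IsStripAnalytic

/-- The graph of the positive, self-adjoint, possibly unbounded operator `A` determined by
`V_t = A^{it}`: a vector `x` is in the domain of `A` if and only if its orbit `t ↦ V_t x = A^{it} x`
continues to a function `F(z) = A^{iz} x` on the strip `-1 ≤ Im z ≤ 0`, and then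
`A x = F(-i)`. -/
def generatorGraph (V : IsometricRep ℂ K) : Submodule ℂ (K × K) where
  carrier := {p | ∃ F : ℂ → K, IsStripAnalytic (-1) 0 F ∧ (∀ t : ℝ, F t = V t p.1) ∧ F (-I) = p.2}
  zero_mem' := ⟨0, .zero _ _, by simp, rfl⟩
  add_mem' := by
    rintro p q ⟨F, hF, hFt, hFi⟩ ⟨G, hG, hGt, hGi⟩
    exact ⟨F + G, hF.add hG, fun t => by simp [hFt, hGt], by simp [hFi, hGi]⟩
  smul_mem' := by
    rintro c p ⟨F, hF, hFt, hFi⟩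
    exact ⟨fun z => (c • ContinuousLinearMap.id ℂ K) (F z), hF.clm_comp _,
      fun t => by simp [hFt], by simp [hFi]⟩

theorem generatorGraph_apply (V : IsometricRep ℂ K) (s : ℝ) {p : K × K}
    (hp : p ∈ generatorGraph V) : (V s p.1, V s p.2) ∈ generatorGraph V := by
  obtain ⟨F, hF, hFt, hFi⟩ := hp
  refine ⟨fun z => (V s).toContinuousLinearMap (F z), hF.clm_comp _, fun t => ?_, by simp [hFi]⟩
  simp [hFt, ← V.add_apply, add_comm]

/-- Positivity of `A`: `⟨x, A x⟩ = ‖A^{1/2} x‖²`. -/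
theorem generatorGraph_inner (V : IsometricRep ℂ K) {p : K × K}
    (hp : p ∈ generatorGraph V) : ∃ v : K, inner ℂ p.1 p.2 = ((‖v‖ ^ 2 : ℝ) : ℂ) := by
  obtain ⟨F, hF, hFt, hFi⟩ := hp
  obtain ⟨hF1, hF2, C, hF3⟩ := id hF
  -- translation covariance of the continuation
  have htr : ∀ (s : ℝ) (z : ℂ), z ∈ im ⁻¹' Set.Icc (-1) 0 → F (z + s) = V s (F z) := by
    intro s z hz
    have h1 : IsStripAnalytic (-1) 0 (fun z => F (z + s)) := by
      have hd : DifferentiableOn ℂ (fun z : ℂ => z + s) Set.univ := by fun_prop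
      refine ⟨hF1.comp (hd.continuousOn.mono (Set.subset_univ _)) ?_,
        hF2.comp (hd.mono (Set.subset_univ _)) ?_, C, ?_⟩
      · intro w hw; simpa using hw
      · intro w hw; simpa using hw
      · intro w hw; exact hF3 _ (by simpa using hw)
    have h2 := h1.sub (hF.clm_comp (V s).toContinuousLinearMap)
    have := h2.eq_zero one_pos (fun t => by
      simp only [Pi.sub_apply, hFt, LinearIsometry.coe_toContinuousLinearMap]
      rw [← ofReal_add, hFt, ← V.add_apply, add_comm, sub_self]) hz
    simpa [sub_eq_zero] using this
  set z₀ : ℂ := ((-(1 / 2) : ℝ) : ℂ) * I with hz₀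
  have hz₀im : z₀.im = -(1 / 2) := by
    simp only [z₀, mul_im, ofReal_re, ofReal_im, I_re, I_im]
    norm_num
  refine ⟨F z₀, ?_⟩
  have hφ1 : IsStripAnalytic (-(1 / 2)) 0 (fun w => innerSL ℂ (F z₀) (F w)) := by
    refine IsStripAnalytic.clm_comp _ ⟨hF1.mono ?_, hF2.mono ?_, C, fun z hz => hF3 z ?_⟩
    · exact Set.preimage_mono (Set.Icc_subset_Icc_left (by norm_num))
    · exact Set.preimage_mono (Set.Ioo_subset_Ioo_left (by norm_num))
    · exact Set.preimage_mono (Set.Icc_subset_Icc_left (by norm_num)) hz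
  let h : ℂ → ℂ := fun u => innerSL ℂ p.1 (F (z₀ - u))
  have hφ2 : IsStripAnalytic (-(1 / 2)) 0 (conj ∘ h ∘ conj) := by
    have hm : ∀ w : ℂ, (z₀ - conj w).im = -(1 / 2) + w.im := fun w => by simp [hz₀im]
    refine ⟨?_, ?_, ‖innerSL ℂ p.1‖ * C, ?_⟩
    · refine Complex.continuous_conj.comp_continuousOn
        ((innerSL ℂ p.1).continuous.comp_continuousOn (hF1.comp ?_ ?_))
      · exact (continuous_const.sub Complex.continuous_conj).continuousOn
      · intro w hw
        simp only [Set.mem_preimage, Set.mem_Icc, hm] at hw ⊢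
        constructor <;> linarith
    · intro w hw
      refine DifferentiableAt.differentiableWithinAt ?_
      rw [differentiableAt_conj_conj_iff]
      refine (innerSL ℂ p.1).differentiableAt.comp _ ?_
      have hopen : IsOpen (im ⁻¹' Set.Ioo (-1 : ℝ) 0) := isOpen_Ioo.preimage Complex.continuous_im
      refine DifferentiableAt.comp (g := F) _ (hF2.differentiableAt (hopen.mem_nhds ?_)) (by fun_prop)
      simp only [Set.mem_preimage, Set.mem_Ioo, hm] at hw ⊢
      constructor <;> linarith
    · intro w hw
      simp only [Function.comp_apply, RCLike.norm_conj, h]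
      refine ((innerSL ℂ p.1).le_opNorm _).trans
        (mul_le_mul_of_nonneg_left (hF3 _ ?_) (norm_nonneg _))
      simp only [Set.mem_preimage, Set.mem_Icc, hm] at hw ⊢
      constructor <;> linarith
  have hz₀mem : z₀ ∈ im ⁻¹' Set.Icc (-(1 / 2) : ℝ) 0 := by simp [hz₀im]
  have key := (hφ1.sub hφ2).eq_zero (by norm_num) (fun t => by
    have e : F (z₀ - (t : ℂ)) = V (-t) (F z₀) := by
      rw [← htr _ _ (by simp [hz₀im]; norm_num)]
      simp [sub_eq_add_neg]
    simp only [Pi.sub_apply, Function.comp_apply, h, conj_ofReal, e, hFt, innerSL_apply_apply]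
    rw [inner_conj_symm, V.inner_apply_left, neg_neg, sub_self]) hz₀mem
  have e2 : z₀ - conj z₀ = -I := by
    apply Complex.ext <;> simp [z₀]
    norm_num
  simp only [Pi.sub_apply, Function.comp_apply, h, e2, hFi, innerSL_apply_apply, sub_eq_zero] at key
  have key' := congrArg conj key
  rw [Complex.conj_conj, inner_conj_symm, inner_self_eq_norm_sq_to_K] at key'
  rw [← key']
  simp

/-- `T` is the bounded operator `2 / (1 + A⁻¹)`, where `V_t = A^{it}`: for every `x` there is `y` in the domain of `A`
with `T x = A y` (that is, `y = A⁻¹ T x`) and `(1 + A⁻¹) T x = 2 x`. -/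
def IsTwoDivOneAddInv (V : IsometricRep ℂ K) (T : K →L[ℂ] K) : Prop :=
  ∀ x : K, ∃ y : K, (y, T x) ∈ generatorGraph V ∧ T x + y = (2 : ℂ) • x

open Classical in
/-- The bounded operator `2 / (1 + A⁻¹)`, where `A` is the positive self-adjoint operator with
`V_t = A^{it}`. On a Hilbert space such a `T` exists, because `A` is positive, self-adjoint and
injective, and it is unique; the value `0` is never used there. -/
noncomputable def twoDivOneAddInv (V : IsometricRep ℂ K) : K →L[ℂ] K :=
  if h : ∃ T, IsTwoDivOneAddInv V T then h.choose else 0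

theorem IsTwoDivOneAddInv.inner_self {V : IsometricRep ℂ K} {T : K →L[ℂ] K}
    (hT : IsTwoDivOneAddInv V T) (x : K) : ∃ r : ℝ, 0 ≤ r ∧ inner ℂ (T x) x = r := by
  obtain ⟨y, hy, hxy⟩ := hT x
  obtain ⟨v, hv⟩ := generatorGraph_inner V hy
  have hx : x = (2⁻¹ : ℂ) • (T x + y) := by rw [hxy, smul_smul]; simp
  refine ⟨(‖T x‖ ^ 2 + ‖v‖ ^ 2) / 2, by positivity, ?_⟩
  conv_lhs => rw [hx]
  have hv' : inner ℂ (T x) y = ((‖v‖ ^ 2 : ℝ) : ℂ) := by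
    rw [← inner_conj_symm, hv, conj_ofReal]
  have h2 : T ((2⁻¹ : ℂ) • (T x + y)) = T x := by rw [← hx]
  rw [h2, inner_smul_right, inner_add_right, hv', inner_self_eq_norm_sq_to_K]
  push_cast
  simp
  ring

theorem IsTwoDivOneAddInv.comm {V : IsometricRep ℂ K} {T : K →L[ℂ] K}
    (hT : IsTwoDivOneAddInv V T) (t : ℝ) (x : K) : T (V t x) = V t (T x) := by
  obtain ⟨y, hy, hxy⟩ := hT x
  obtain ⟨y', hy', hxy'⟩ := hT (V t x)
  have hd := (generatorGraph V).sub_mem hy' (generatorGraph_apply V t hy)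
  obtain ⟨v, hv⟩ := generatorGraph_inner V hd
  have hs : (T (V t x) - V t (T x)) = -(y' - V t y) := by
    have h1 : V t (T x) + V t y = (2 : ℂ) • V t x := by rw [← map_add, hxy, map_smul]
    rw [← sub_eq_zero]
    have : T (V t x) - V t (T x) - -(y' - V t y) = (T (V t x) + y') - (V t (T x) + V t y) := by abel
    rw [this, hxy', h1, sub_self]
  simp only [Prod.mk_sub_mk] at hv
  rw [hs, inner_neg_right, inner_self_eq_norm_sq_to_K] at hv
  have hv' : -(‖y' - V t y‖ ^ 2) = ‖v‖ ^ 2 := by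
    have := congrArg Complex.re hv
    rw [ofReal_re] at this
    rw [← this]
    norm_cast
  have h0 : ‖y' - V t y‖ ^ 2 = 0 := by nlinarith [sq_nonneg ‖v‖, sq_nonneg ‖y' - V t y‖]
  have h0' : y' - V t y = 0 := by simpa using h0
  rw [h0', neg_zero] at hs
  exact sub_eq_zero.1 hs

theorem twoDivOneAddInv_inner_self (V : IsometricRep ℂ K) (x : K) :
    ∃ r : ℝ, 0 ≤ r ∧ inner ℂ (twoDivOneAddInv V x) x = r := by
  unfold twoDivOneAddInv
  split_ifs with h
  · exact h.choose_spec.inner_self x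
  · exact ⟨0, le_rfl, by simp⟩

theorem twoDivOneAddInv_comm (V : IsometricRep ℂ K) (t : ℝ) (x : K) :
    twoDivOneAddInv V (V t x) = V t (twoDivOneAddInv V x) := by
  unfold twoDivOneAddInv
  split_ifs with h
  · exact h.choose_spec.comm t x
  · simp

theorem twoDivOneAddInv_isSymmetric (V : IsometricRep ℂ K) :
    (twoDivOneAddInv V : K →ₗ[ℂ] K).IsSymmetric := by
  rw [LinearMap.isSymmetric_iff_inner_map_self_real]
  intro x
  obtain ⟨r, -, hr⟩ := twoDivOneAddInv_inner_self V x
  simp [hr]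

end Generator
/-! ### The one-particle space -/

section OneParticle

variable {H : Type*} [NormedAddCommGroup H] [InnerProductSpace ℝ H]

/-- The space `H_ℂ`, to be equipped with `⟨x, y⟩_U = ⟨2 (1 + A⁻¹)⁻¹ x, y⟩` where `U_t = A^{it}`. -/
def PreOneParticle (_U : IsometricRep ℝ H) : Type _ := Complexification H

variable (U : IsometricRep ℝ H)

noncomputable instance : AddCommGroup (PreOneParticle U) :=
  inferInstanceAs (AddCommGroup (Complexification H))

noncomputable instance : Module ℂ (PreOneParticle U) :=
  inferInstanceAs (Module ℂ (Complexification H))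

/-- The identity map `H_ℂ → (H_ℂ, ⟨·,·⟩_U)`. -/
noncomputable def toPreOneParticle : Complexification H ≃ₗ[ℂ] PreOneParticle U := LinearEquiv.refl ℂ _

noncomputable instance preOneParticleCore : PreInnerProductSpace.Core ℂ (PreOneParticle U) where
  inner x y := inner ℂ (twoDivOneAddInv U.complexify ((toPreOneParticle U).symm x))
    ((toPreOneParticle U).symm y)
  conj_inner_symm x y := by
    rw [inner_conj_symm]
    exact (twoDivOneAddInv_isSymmetric U.complexify _ _).symm
  re_inner_nonneg x := by
    obtain ⟨r, hr, h⟩ := twoDivOneAddInv_inner_self U.complexify ((toPreOneParticle U).symm x)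
    rw [h]
    simpa using hr
  add_left x y z := by rw [map_add, map_add, inner_add_left]
  smul_left x y c := by rw [map_smul, map_smul, inner_smul_left]

noncomputable instance : SeminormedAddCommGroup (PreOneParticle U) :=
  InnerProductSpace.Core.toSeminormedAddCommGroup (𝕜 := ℂ)

noncomputable instance : InnerProductSpace ℂ (PreOneParticle U) := .ofCore _

theorem PreOneParticle.inner_def (x y : PreOneParticle U) :
    inner ℂ x y = inner ℂ (twoDivOneAddInv U.complexify ((toPreOneParticle U).symm x))
      ((toPreOneParticle U).symm y) := rfl

/-- The action of `(U_t)` on `(H_ℂ, ⟨·,·⟩_U)`. -/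
noncomputable def preOneParticleRep : IsometricRep ℂ (PreOneParticle U) where
  toFun t := ((toPreOneParticle U).toLinearMap ∘ₗ (U.complexify t).toLinearMap ∘ₗ
    (toPreOneParticle U).symm.toLinearMap).isometryOfInner fun x y => by
      simp [PreOneParticle.inner_def, twoDivOneAddInv_comm]
  map_zero' := by
    ext x
    exact U.complexify.zero_apply _
  map_add' s t := by
    ext x
    exact U.complexify.add_apply _ _ _
  continuous' x := by
    have hb : ∀ z : Complexification H, ‖toPreOneParticle U z‖ ^ 2 ≤
        ‖twoDivOneAddInv U.complexify‖ * ‖z‖ ^ 2 := by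
      intro z
      rw [norm_sq_eq_re_inner (𝕜 := ℂ), PreOneParticle.inner_def]
      simp only [LinearEquiv.symm_apply_apply]
      refine (RCLike.re_le_norm _).trans ((norm_inner_le_norm _ _).trans ?_)
      rw [sq, ← mul_assoc]
      exact mul_le_mul_of_nonneg_right (ContinuousLinearMap.le_opNorm _ _) (norm_nonneg _)
    have hc : Continuous (toPreOneParticle U).toLinearMap := by
      refine AddMonoidHomClass.continuous_of_bound _ (√‖twoDivOneAddInv U.complexify‖)
        fun z => ?_
      refine abs_le_of_sq_le_sq' ?_ (by positivity) |>.2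
      rw [mul_pow, Real.sq_sqrt (norm_nonneg _)]
      exact hb z
    exact hc.comp (U.complexify.continuous' ((toPreOneParticle U).symm x))

/-- The complex Hilbert space `H`, the completion of `H_ℂ` with respect to `⟨·,·⟩_U`. -/
abbrev OneParticle : Type _ := UniformSpace.Completion (PreOneParticle U)

/-- The unitary representation `(U_t)` on `H`. -/
noncomputable def oneParticleRep : IsometricRep ℂ (OneParticle U) := (preOneParticleRep U).completion

/-- The inclusion `H_ℝ ⊆ H_ℂ ⊆ H`. -/
noncomputable def realInclusion (x : H) : OneParticle U :=
  ((toPreOneParticle U (.mk x 0) : PreOneParticle U) : UniformSpace.Completion _)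

theorem oneParticleRep_realInclusion (t : ℝ) (x : H) :
    oneParticleRep U t (realInclusion U x) = realInclusion U (U t x) := by
  change ((preOneParticleRep U) t).toContinuousLinearMap.completion _ = _
  rw [realInclusion, ContinuousLinearMap.completion_apply_coe]
  congr 1
  change Complexification.mk (U t x) (U t 0) = Complexification.mk (U t x) 0
  rw [map_zero]

end OneParticle

/-! ### The full Fock space -/

section Fock

variable {E : Type*} [NormedAddCommGroup E] [InnerProductSpace ℂ E]

/-- The inner product of two simple tensors in `⨁ₙ E^{⊗ n}`, the list `[v₁, …, vₙ]` standing for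
`v₁ ⊗ ⋯ ⊗ vₙ` and the empty list for the vacuum vector:
`⟨v₁ ⊗ ⋯ ⊗ vₙ, w₁ ⊗ ⋯ ⊗ wₙ⟩ = ∏ ⟨vᵢ, wᵢ⟩`, tensors of different degrees being orthogonal. -/
noncomputable def tensorInner : List E → List E → ℂ
  | [], [] => 1
  | v :: vs, w :: ws => inner ℂ v w * tensorInner vs ws
  | [], _ :: _ => 0
  | _ :: _, [] => 0

theorem tensorInner_conj : ∀ v w : List E, conj (tensorInner v w) = tensorInner w v
  | [], [] => by simp [tensorInner]
  | v :: vs, w :: ws => by simp [tensorInner, tensorInner_conj vs ws]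
  | [], _ :: _ => by simp [tensorInner]
  | _ :: _, [] => by simp [tensorInner]

open scoped ComplexOrder in
theorem posSemidef_gram {X F : Type*} [SeminormedAddCommGroup F] [InnerProductSpace ℂ F]
    (f : X → F) : (Matrix.gram ℂ f).PosSemidef := by
  refine ⟨Matrix.isHermitian_gram ℂ f, fun x => ?_⟩
  have h : (x.sum fun i a => x.sum fun j b => star a * Matrix.gram ℂ f i j * b) =
      inner ℂ (x.sum fun i a => a • f i) (x.sum fun i a => a • f i) := by
    simp only [Finsupp.sum, sum_inner]
    refine Finset.sum_congr rfl fun i _ => ?_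
    rw [inner_sum]
    refine Finset.sum_congr rfl fun j _ => ?_
    rw [inner_smul_left, inner_smul_right, Matrix.gram_apply, RCLike.star_def]
    ring
  rw [h, inner_self_eq_norm_sq_to_K, ← RCLike.ofReal_pow]
  exact RCLike.ofReal_nonneg.2 (sq_nonneg _)

open scoped ComplexOrder in
theorem tensorInner_posSemidef :
    (Matrix.of fun v w : List E => tensorInner v w).PosSemidef := by
  classical
  -- truncations of the kernel to tensors of degree less than `n`
  have key : ∀ n : ℕ, ∃ M : Matrix (List E) (List E) ℂ, M.PosSemidef ∧
      ∀ v w : List E, v.length < n → w.length < n → M v w = tensorInner v w := by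
    intro n
    induction n with
    | zero => exact ⟨0, .zero, by simp⟩
    | succ n ih =>
      obtain ⟨M, hM, hMv⟩ := ih
      let e : List E → ℂ := fun v => if v = [] then 1 else 0
      let G : Matrix (List E) (List E) ℂ := Matrix.gram ℂ fun v : List E => v.headD 0
      refine ⟨Matrix.gram ℂ e + Matrix.hadamard G (M.submatrix List.tail List.tail),
        (posSemidef_gram e).add
          ((posSemidef_gram _).hadamard (hM.submatrix _)), ?_⟩
      rintro (_ | ⟨v, vs⟩) (_ | ⟨w, ws⟩) hv hw
      · simp [e, G, Matrix.gram_apply, tensorInner]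
      · simp [e, G, Matrix.gram_apply, tensorInner]
      · simp [e, G, Matrix.gram_apply, tensorInner]
      · simp only [List.length_cons, add_lt_add_iff_right] at hv hw
        simp [e, G, Matrix.gram_apply, tensorInner, hMv _ _ hv hw]
  refine ⟨?_, fun x => ?_⟩
  · ext v w
    simpa using tensorInner_conj w v
  · obtain ⟨M, hM, hMv⟩ := key (x.support.sup List.length + 1)
    refine (hM.2 x).trans_eq ?_
    refine Finset.sum_congr rfl fun v hv => Finset.sum_congr rfl fun w hw => ?_
    beta_reduce
    rw [hMv v w (Nat.lt_succ_of_le (Finset.le_sup hv)) (Nat.lt_succ_of_le (Finset.le_sup hw))]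
    rfl

/-- Formal linear combinations of simple tensors. With the inner product below, two of them are at
distance `0` exactly when they define the same element of the algebraic direct sum
`⨁ₙ E^{⊗ n}`. -/
abbrev PreFock (E : Type*) : Type _ := List E →₀ ℂ

/-- The sesquilinear form on formal combinations. -/
noncomputable def preFockInner (f g : List E →₀ ℂ) : ℂ :=
  f.sum fun v a => g.sum fun w b => conj a * tensorInner v w * b

noncomputable instance preFockCore : PreInnerProductSpace.Core ℂ (PreFock E) where
  inner f g := preFockInner f g
  conj_inner_symm f g := by
    simp only [preFockInner, Finsupp.sum, map_sum, map_mul, Complex.conj_conj, tensorInner_conj]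
    rw [Finset.sum_comm]
    exact Finset.sum_congr rfl fun _ _ => Finset.sum_congr rfl fun _ _ => by ring
  re_inner_nonneg f := (Complex.le_def.1 (tensorInner_posSemidef.2 f)).1
  add_left f g h := by
    simp only [preFockInner]
    rw [Finsupp.sum_add_index'] <;> simp [add_mul]
  smul_left f g c := by
    simp only [preFockInner]
    rw [Finsupp.sum_smul_index (by simp)]
    simp [Finsupp.mul_sum, mul_assoc]

noncomputable instance : SeminormedAddCommGroup (PreFock E) :=
  InnerProductSpace.Core.toSeminormedAddCommGroup (𝕜 := ℂ)

noncomputable instance : InnerProductSpace ℂ (PreFock E) := .ofCore _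

/-- The simple tensor `v₁ ⊗ ⋯ ⊗ vₙ`. -/
noncomputable def preTensor (v : List E) : PreFock E := Finsupp.single v (1 : ℂ)

/-- The linear map induced by a map of simple tensors. -/
noncomputable def preFockMap (φ : List E → List E) : PreFock E →ₗ[ℂ] PreFock E :=
  Finsupp.lmapDomain ℂ ℂ φ

theorem preFockMap_inner {φ : List E → List E} {c : ℂ}
    (hφ : ∀ v w, tensorInner (φ v) (φ w) = c * tensorInner v w) (f g : PreFock E) :
    inner ℂ (preFockMap φ f) (preFockMap φ g) = c * inner ℂ f g := by
  change preFockInner (Finsupp.mapDomain φ f) (Finsupp.mapDomain φ g) = c * preFockInner f g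
  rw [preFockInner, Finsupp.sum_mapDomain_index (by simp) (by simp [add_mul])]
  simp_rw [Finsupp.sum_mapDomain_index (h := fun w b => conj _ * tensorInner _ w * b)
    (fun _ => mul_zero _) (fun _ _ _ => mul_add _ _ _), hφ]
  simp only [preFockInner, Finsupp.mul_sum]
  exact Finset.sum_congr rfl fun _ _ => Finset.sum_congr rfl fun _ _ => by ring

/-- The full Fock space `ℂΩ ⊕ ⨁_{n ≥ 1} E^{⊗ n}` (Hilbert space tensor powers and direct sum). -/
abbrev FockSpace (E : Type*) [NormedAddCommGroup E] [InnerProductSpace ℂ E] : Type _ :=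
  UniformSpace.Completion (PreFock E)

/-- The simple tensor `v₁ ⊗ ⋯ ⊗ vₙ` as a vector of the full Fock space. -/
noncomputable def tensor (v : List E) : FockSpace E := (preTensor v : PreFock E)

/-- The vacuum vector `Ω`. -/
noncomputable def vacuum (E : Type*) [NormedAddCommGroup E] [InnerProductSpace ℂ E] : FockSpace E :=
  tensor []

/-- The left creation operator: `ℓ(x) Ω = x`, `ℓ(x) (v₁ ⊗ ⋯ ⊗ vₙ) = x ⊗ v₁ ⊗ ⋯ ⊗ vₙ`. -/
noncomputable def creation (x : E) : FockSpace E →L[ℂ] FockSpace E :=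
  ((preFockMap (List.cons x)).mkContinuous ‖x‖ fun f => by
    refine abs_le_of_sq_le_sq' ?_ (by positivity) |>.2
    refine le_of_eq ?_
    rw [mul_pow, norm_sq_eq_re_inner (𝕜 := ℂ), preFockMap_inner (c := inner ℂ x x) (by
      simp [tensorInner]), inner_self_eq_norm_sq_to_K, inner_self_eq_norm_sq_to_K]
    norm_cast).completion

theorem tensorInner_map (V : E →ₗᵢ[ℂ] E) (v w : List E) :
    tensorInner (v.map V) (w.map V) = tensorInner v w := by
  induction v generalizing w with
  | nil => cases w <;> simp [tensorInner]
  | cons a v ih => cases w <;> simp [tensorInner, ih]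

theorem preFock_inner_single (v w : List E) (a b : ℂ) :
    inner ℂ (Finsupp.single v a : PreFock E) (Finsupp.single w b : PreFock E) =
      conj a * tensorInner v w * b := by
  change preFockInner _ _ = _
  simp [preFockInner]

theorem continuous_preFockMap (V : IsometricRep ℂ E) (f : PreFock E) :
    Continuous fun t => preFockMap (List.map (V t)) f := by
  have hinner : ∀ v w : List E, Continuous fun t => tensorInner (v.map (V t)) w := by
    intro v
    induction v with
    | nil => intro w; cases w <;> simp [tensorInner, continuous_const]
    | cons a v ih =>
      intro w
      cases w with
      | nil => simp [tensorInner, continuous_const]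
      | cons b w =>
        simp only [List.map_cons, tensorInner]
        exact ((V.continuous' a).inner continuous_const).mul (ih w)
  induction f using Finsupp.induction_linear with
  | zero => simp [continuous_const]
  | add f g hf hg =>
    simp only [map_add]
    exact hf.add hg
  | single v a =>
    let g : ℝ → PreFock E := fun t => Finsupp.single (v.map (V t)) a
    have hg : (fun t => preFockMap (List.map (V t)) (Finsupp.single v a)) = g :=
      funext fun t => Finsupp.mapDomain_single
    rw [hg]
    have hself : ∀ t, ‖g t‖ ^ 2 = RCLike.re (conj a * tensorInner v v * a) := fun t => by
      rw [norm_sq_eq_re_inner (𝕜 := ℂ), preFock_inner_single, tensorInner_map]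
    refine continuous_iff_continuousAt.2 fun s => tendsto_iff_norm_sub_tendsto_zero.2 ?_
    have hsq : ∀ t, ‖g t - g s‖ = √(‖g t‖ ^ 2 - 2 * RCLike.re (inner ℂ (g t) (g s)) + ‖g s‖ ^ 2) :=
      fun t => by rw [← norm_sub_sq (𝕜 := ℂ), Real.sqrt_sq (norm_nonneg _)]
    have hcont : Continuous fun t =>
        √(‖g t‖ ^ 2 - 2 * RCLike.re (inner ℂ (g t) (g s)) + ‖g s‖ ^ 2) := by
      simp only [hself, g, preFock_inner_single]
      have := hinner v (v.map (V s))
      fun_prop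
    have := hcont.tendsto s
    simp only [← hsq, sub_self, norm_zero] at this
    exact this

/-- The action of `V_t ⊗ ⋯ ⊗ V_t` on finite combinations of simple tensors. -/
noncomputable def preSecondQuantization (V : IsometricRep ℂ E) : IsometricRep ℂ (PreFock E) where
  toFun t := (preFockMap (List.map (V t))).isometryOfInner fun f g => by
    rw [preFockMap_inner (c := 1) fun v w => by rw [one_mul, tensorInner_map], one_mul]
  map_zero' := by
    refine LinearIsometry.ext fun f => ?_
    change Finsupp.mapDomain (List.map (V 0)) f = f
    rw [V.map_zero', LinearIsometry.coe_id, List.map_id_fun, Finsupp.mapDomain_id]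
  map_add' s t := by
    refine LinearIsometry.ext fun f => ?_
    change Finsupp.mapDomain _ f = Finsupp.mapDomain _ (Finsupp.mapDomain _ f)
    rw [V.map_add', ← Finsupp.mapDomain_comp, LinearIsometry.coe_comp, List.map_comp_map]
  continuous' f := continuous_preFockMap V f

/-- The second quantization `𝓕(V_t) = ⨁ₙ V_t^{⊗ n}`. -/
noncomputable def secondQuantization (V : IsometricRep ℂ E) : IsometricRep ℂ (FockSpace E) :=
  (preSecondQuantization V).completion

theorem creation_tensor (x : E) (v : List E) : creation x (tensor v) = tensor (x :: v) := by
  rw [creation, tensor, ContinuousLinearMap.completion_apply_coe]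
  congr 1
  exact Finsupp.mapDomain_single

theorem secondQuantization_tensor (V : IsometricRep ℂ E) (t : ℝ) (v : List E) :
    secondQuantization V t (tensor v) = tensor (v.map (V t)) := by
  change ((preSecondQuantization V) t).toContinuousLinearMap.completion _ = _
  rw [tensor, ContinuousLinearMap.completion_apply_coe]
  congr 1
  exact Finsupp.mapDomain_single

theorem inner_tensor (v w : List E) : inner ℂ (tensor v) (tensor w) = tensorInner v w := by
  rw [tensor, tensor, UniformSpace.Completion.inner_coe]
  rw [preTensor, preTensor, preFock_inner_single]
  simp

end Fock
/-! ### Von Neumann algebras, modular groups, mixing -/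

section VonNeumann

variable {K : Type*} [NormedAddCommGroup K] [InnerProductSpace ℂ K] [CompleteSpace K]

/-- The von Neumann algebra `S''` generated by a set of bounded operators: the bicommutant of
`S ∪ S*`. -/
noncomputable def generatedVonNeumannAlgebra (S : Set (K →L[ℂ] K)) : VonNeumannAlgebra K where
  toStarSubalgebra :=
    StarSubalgebra.centralizer ℂ (StarSubalgebra.centralizer ℂ S : Set (K →L[ℂ] K))
  centralizer_centralizer' := by
    change Set.centralizer (Set.centralizer
      ((StarSubalgebra.centralizer ℂ (StarSubalgebra.centralizer ℂ S : Set (K →L[ℂ] K)) :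
        StarSubalgebra ℂ (K →L[ℂ] K)) : Set (K →L[ℂ] K))) =
      ((StarSubalgebra.centralizer ℂ (StarSubalgebra.centralizer ℂ S : Set (K →L[ℂ] K)) :
        StarSubalgebra ℂ (K →L[ℂ] K)) : Set (K →L[ℂ] K))
    rw [StarSubalgebra.coe_centralizer_centralizer, Set.centralizer_centralizer_centralizer]

/-- The vector functional `x ↦ ⟨x Ω, Ω⟩` (the inner product being linear in `x Ω`). -/
noncomputable def vectorState (M : VonNeumannAlgebra K) (Ω : K) (x : M.toStarSubalgebra) : ℂ :=
  inner ℂ Ω ((x : K →L[ℂ] K) Ω)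

/-- `φ` is faithful: `φ(x^* x) = 0` only for `x = 0`. -/
def IsFaithfulState (M : VonNeumannAlgebra K) (φ : M.toStarSubalgebra → ℂ) : Prop :=
  ∀ x : M.toStarSubalgebra, φ (star x * x) = 0 → x = 0

/-- `(σ_t)` is the modular automorphism group of the state `φ` on `M`: a strongly continuous
one-parameter group of `*`-automorphisms which preserves `φ` and satisfies the modular (KMS)
condition. (For a faithful normal state there is exactly one such group.) -/
structure IsModularGroup (M : VonNeumannAlgebra K) (φ : M.toStarSubalgebra → ℂ)
    (σ : ℝ → M.toStarSubalgebra ≃⋆ₐ[ℂ] M.toStarSubalgebra) : Prop where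
  add_apply : ∀ s t x, σ (s + t) x = σ s (σ t x)
  continuous : ∀ (x : M.toStarSubalgebra) (v : K),
    Continuous fun t => ((σ t x : M.toStarSubalgebra) : K →L[ℂ] K) v
  invariant : ∀ t x, φ (σ t x) = φ x
  kms : ∀ x y : M.toStarSubalgebra, ∃ F : ℂ → ℂ, IsStripAnalytic 0 1 F ∧
    ∀ t : ℝ, F t = φ (σ t x * y) ∧ F (t + I) = φ (y * σ t x)

/-- The action `(σ_t)` on `M` is `φ`-mixing: `φ(σ_t(x) y) → 0` as `|t| → ∞` whenever
`φ(x) = φ(y) = 0`. -/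
def IsStateMixing (M : VonNeumannAlgebra K) (φ : M.toStarSubalgebra → ℂ)
    (σ : ℝ → M.toStarSubalgebra ≃⋆ₐ[ℂ] M.toStarSubalgebra) : Prop :=
  ∀ x y : M.toStarSubalgebra, φ x = 0 → φ y = 0 →
    Tendsto (fun t => φ (σ t x * y)) (cocompact ℝ) (𝓝 0)

/-- `Ad(V_t) x = V_t x V_t^*` for a unitary representation `(V_t)`. -/
noncomputable def IsometricRep.ad (V : IsometricRep ℂ K) (t : ℝ) (x : K →L[ℂ] K) : K →L[ℂ] K :=
  (V t).toContinuousLinearMap * x * (V (-t)).toContinuousLinearMap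

theorem IsometricRep.ad_apply (V : IsometricRep ℂ K) (t : ℝ) (x : K →L[ℂ] K) (v : K) :
    V.ad t x v = V t (x (V (-t) v)) := rfl

theorem IsometricRep.ad_mul (V : IsometricRep ℂ K) (t : ℝ) (x y : K →L[ℂ] K) :
    V.ad t (x * y) = V.ad t x * V.ad t y := by
  ext v
  simp [V.ad_apply, V.neg_apply_self]

theorem IsometricRep.ad_star (V : IsometricRep ℂ K) (t : ℝ) (x : K →L[ℂ] K) :
    V.ad t (star x) = star (V.ad t x) := by
  ext v
  refine ext_inner_left ℂ fun w => ?_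
  rw [ContinuousLinearMap.star_eq_adjoint, ContinuousLinearMap.star_eq_adjoint,
    ContinuousLinearMap.adjoint_inner_right, V.ad_apply, V.ad_apply, V.inner_apply_left t (x _),
    ← ContinuousLinearMap.adjoint_inner_right, V.inner_apply_left (-t) w, neg_neg]

theorem IsometricRep.ad_neg_ad (V : IsometricRep ℂ K) (t : ℝ) (x : K →L[ℂ] K) :
    V.ad (-t) (V.ad t x) = x := by
  ext v
  rw [V.ad_apply, V.ad_apply, V.neg_apply_self, V.apply_neg_self (-t)]

theorem IsometricRep.ad_ad_neg (V : IsometricRep ℂ K) (t : ℝ) (x : K →L[ℂ] K) :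
    V.ad t (V.ad (-t) x) = x := by
  simpa using V.ad_neg_ad (-t) x

/-- The restriction of `(Ad(V_t))` to an invariant von Neumann algebra. -/
noncomputable def IsometricRep.adRestrict (V : IsometricRep ℂ K) (M : VonNeumannAlgebra K)
    (hM : ∀ (t : ℝ), ∀ x ∈ M.toStarSubalgebra, V.ad t x ∈ M.toStarSubalgebra) (t : ℝ) :
    M.toStarSubalgebra ≃⋆ₐ[ℂ] M.toStarSubalgebra where
  toFun x := ⟨V.ad t x, hM t x x.2⟩
  invFun x := ⟨V.ad (-t) x, hM (-t) x x.2⟩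
  left_inv x := Subtype.ext (V.ad_neg_ad t x)
  right_inv x := Subtype.ext (V.ad_ad_neg t x)
  map_mul' x y := Subtype.ext (V.ad_mul t x y)
  map_add' x y := Subtype.ext (by ext v; simp [V.ad_apply])
  map_star' x := Subtype.ext (V.ad_star t x)
  map_smul' c x := Subtype.ext (by ext v; simp [V.ad_apply])

theorem IsometricRep.ad_mem_generated (V : IsometricRep ℂ K) (S : Set (K →L[ℂ] K))
    (hS : ∀ t, ∀ x ∈ S, V.ad t x ∈ S) (t : ℝ) (x : K →L[ℂ] K)
    (hx : x ∈ (generatedVonNeumannAlgebra S).toStarSubalgebra) :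
    V.ad t x ∈ (generatedVonNeumannAlgebra S).toStarSubalgebra := by
  have hc : ∀ (s : ℝ), ∀ c ∈ StarSubalgebra.centralizer ℂ S,
      V.ad s c ∈ StarSubalgebra.centralizer ℂ S := by
    intro s c hc
    rw [StarSubalgebra.mem_centralizer_iff] at hc ⊢
    intro g hg
    obtain ⟨h1, h2⟩ := hc _ (hS (-s) g hg)
    rw [← V.ad_star] at h2
    have e1 := congrArg (V.ad s) h1
    have e2 := congrArg (V.ad s) h2
    simp only [V.ad_mul, V.ad_ad_neg] at e1 e2
    exact ⟨e1, e2⟩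
  change _ ∈ StarSubalgebra.centralizer ℂ _ at hx ⊢
  rw [StarSubalgebra.mem_centralizer_iff] at hx ⊢
  intro g hg
  have hg' := hc (-t) g hg
  have key : ∀ g ∈ StarSubalgebra.centralizer ℂ S, g * V.ad t x = V.ad t x * g := by
    intro g hg
    have := congrArg (V.ad t) (hx _ (hc (-t) g hg)).1
    simpa only [V.ad_mul, V.ad_ad_neg] using this
  exact ⟨key g hg, key _ (star_mem hg)⟩

end VonNeumann

/-! ### Free Araki–Woods algebras -/

section FockOperators

variable {E : Type*} [NormedAddCommGroup E] [InnerProductSpace ℂ E]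

/-- `s(x) = (ℓ(x) + ℓ(x)^*) / 2`. -/
noncomputable def semicircular (x : E) : FockSpace E →L[ℂ] FockSpace E :=
  (2⁻¹ : ℂ) • (creation x + star (creation x))

theorem secondQuantization_creation (V : IsometricRep ℂ E) (t : ℝ) (x : E) (f : FockSpace E) :
    secondQuantization V t (creation x f) = creation (V t x) (secondQuantization V t f) := by
  induction f using UniformSpace.Completion.induction_on with
  | hp =>
    exact isClosed_eq ((secondQuantization V t).continuous.comp (creation x).continuous)
      ((creation _).continuous.comp (secondQuantization V t).continuous)
  | ih f =>
    induction f using Finsupp.induction_linear with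
    | zero =>
      rw [show ((0 : PreFock E) : FockSpace E) = 0 from UniformSpace.Completion.coe_zero]
      simp
    | add f g hf hg => simp only [UniformSpace.Completion.coe_add, map_add, hf, hg]
    | single v a =>
      have : ((Finsupp.single v a : PreFock E) : FockSpace E) = a • tensor v := by
        rw [tensor, ← UniformSpace.Completion.coe_smul, preTensor, Finsupp.smul_single, smul_eq_mul,
          mul_one]
      rw [this]
      simp only [map_smul, creation_tensor, secondQuantization_tensor, List.map_cons]

theorem ad_secondQuantization_creation (V : IsometricRep ℂ E) (t : ℝ) (x : E) :
    (secondQuantization V).ad t (creation x) = creation (V t x) := by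
  ext f
  rw [IsometricRep.ad_apply, secondQuantization_creation, IsometricRep.apply_neg_self]

theorem ad_secondQuantization_semicircular (V : IsometricRep ℂ E) (t : ℝ) (x : E) :
    (secondQuantization V).ad t (semicircular x) = semicircular (V t x) := by
  rw [semicircular, semicircular, ← ad_secondQuantization_creation, ← IsometricRep.ad_star]
  ext f
  simp [IsometricRep.ad_apply]

end FockOperators

section FreeArakiWoods

variable {H : Type*} [NormedAddCommGroup H] [InnerProductSpace ℝ H] (U : IsometricRep ℝ H)

/-- The free Araki–Woods von Neumann algebra `Γ(H_ℝ, U_t)'' = {s(x) : x ∈ H_ℝ}''`. -/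
noncomputable def freeArakiWoods : VonNeumannAlgebra (FockSpace (OneParticle U)) :=
  generatedVonNeumannAlgebra (Set.range fun x : H => semicircular (realInclusion U x))

/-- The free quasi-free state `φ_U = ⟨· Ω, Ω⟩`. -/
noncomputable def quasiFreeState : (freeArakiWoods U).toStarSubalgebra → ℂ :=
  vectorState (freeArakiWoods U) (vacuum (OneParticle U))

theorem ad_mem_freeArakiWoods (t : ℝ) (x : FockSpace (OneParticle U) →L[ℂ] FockSpace (OneParticle U))
    (hx : x ∈ (freeArakiWoods U).toStarSubalgebra) :
    (secondQuantization (oneParticleRep U)).ad t x ∈ (freeArakiWoods U).toStarSubalgebra := by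
  refine IsometricRep.ad_mem_generated _ _ ?_ t x hx
  rintro s _ ⟨y, rfl⟩
  exact ⟨U s y, by rw [ad_secondQuantization_semicircular, oneParticleRep_realInclusion]⟩

/-- The group `σ_t = Ad(𝓕(U_{-t}))` of automorphisms of the free Araki–Woods algebra. -/
noncomputable def freeModularGroup (t : ℝ) :
    (freeArakiWoods U).toStarSubalgebra ≃⋆ₐ[ℂ] (freeArakiWoods U).toStarSubalgebra :=
  (secondQuantization (oneParticleRep U)).adRestrict (freeArakiWoods U) (ad_mem_freeArakiWoods U) (-t)

end FreeArakiWoods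

end FreeArakiWoods

/-! Since `𝓕(U_t)` fixes `Ω`, one has `φ_U(σ_t(x) y) = ⟨x^*Ω, 𝓕(U_t) yΩ⟩` and `φ_U(y σ_t(x)) =
⟨𝓕(U_t) y^*Ω, xΩ⟩` (conjugate linear on the left). The modular condition and mixing thus become
statements about matrix coefficients of `𝓕(U_t)`, and through them about the one-particle space.

The one-particle space is governed by `T = 2/(1 + A⁻¹)`. As `A` is given only by analytic
continuation of orbits, the existence of `T` has to be proved (`exists_isTwoDivOneAddInv`): the
graph of `A` is closed, positivity bounds `1 + A` from below, and `1 + A` has dense range by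
Gaussian smoothing and Liouville's theorem. The conjugation `J` of `H_ℂ` is antilinear and commutes
with `A^{it}`, so `J A J = A⁻¹` and `J T J = 2 - T` (`twoDivOneAddInv_conjugation`). This identity
yields the KMS relation on one-particle vectors, the equality `Re ⟨x, y⟩_U = ⟨x, y⟩` on `H_ℝ`, and a
dense set of vectors `a` having a partner `b` with `⟨x, a⟩_U = ⟨b, x⟩_U` for all `x ∈ H_ℝ`.

Faithfulness: for such a pair, `r(a) + r(b)^*` built from right creation operators commutes with
every `s(x)`, hence with the whole algebra. These operators move `Ω` through a total set, so `xΩ =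
0` forces `x = 0` (`eq_zero_of_apply_vacuum_eq_zero`).

KMS: the Wick word of `v` sends `Ω` to the tensor `v`, and its adjoint is the Wick word of the
reversed list, so for Wick words the required function is a product of one-particle ones. A
bicommutant argument approximates `xΩ` and `x^*Ω` simultaneously by spans of Wick words
(`exists_seq_tendsto_of_mem_generated`), and the maximum principle on the strip lets the analytic
functions pass to the limit (`SatisfiesKMS.of_tendsto`).

Mixing: if `(U_t)` is mixing, `𝓕(U_t)` tends weakly to the projection onto `ℂΩ`
(`tendsto_inner_secondQuantization`), so `φ_U(σ_t(x) y)` tends to `φ_U(x) φ_U(y)`. Conversely, `x =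
s(ξ)` and `y = s(η)` give `⟨ξ, U_t η⟩_U / 4`, whose real part is a quarter of the original
coefficient. -/

namespace FreeArakiWoods

open Complex Filter Topology
open scoped ComplexConjugate

/-! ### Maximum principle and uniform limits on strips -/

section Strip

variable {E : Type*} [NormedAddCommGroup E] [InnerProductSpace ℂ E]

theorem IsStripAnalytic.diffContOnCl {a b : ℝ} (hab : a < b) {F : ℂ → E}
    (hF : IsStripAnalytic a b F) : DiffContOnCl ℂ F (im ⁻¹' Set.Ioo a b) := by
  refine ⟨hF.2.1, ?_⟩
  rw [closure_preimage_im, closure_Ioo hab.ne]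
  exact hF.1

/-- The maximum principle on a strip. -/
theorem IsStripAnalytic.norm_le {a b : ℝ} (hab : a < b) {F : ℂ → E}
    (hF : IsStripAnalytic a b F) {C : ℝ} (ha : ∀ t : ℝ, ‖F (t + a * I)‖ ≤ C)
    (hb : ∀ t : ℝ, ‖F (t + b * I)‖ ≤ C) {z : ℂ} (hz : z ∈ im ⁻¹' Set.Icc a b) : ‖F z‖ ≤ C := by
  obtain ⟨D, hD⟩ := hF.2.2
  -- Boundedness of `F` is the growth condition with both exponential constants equal to `0`.
  refine PhragmenLindelof.horizontal_strip (hF.diffContOnCl hab)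
    ⟨0, div_pos Real.pi_pos (sub_pos.2 hab), 0, ?_⟩ ?_ ?_ hz.1 hz.2
  · simp only [zero_mul, Real.exp_zero]
    refine Asymptotics.IsBigO.of_bound D ?_
    refine mem_inf_of_right fun w hw => ?_
    simpa using hD w ⟨hw.1.le, hw.2.le⟩
  · intro w hw
    have := ha w.re
    rwa [← hw, re_add_im] at this
  · intro w hw
    have := hb w.re
    rwa [← hw, re_add_im] at this

/-- Strip-analytic functions whose boundary values converge uniformly converge to a strip-analytic
function. -/
theorem exists_isStripAnalytic_of_tendstoUniformly [CompleteSpace E] {a b : ℝ} (hab : a < b)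
    {F : ℕ → ℂ → E} (hF : ∀ n, IsStripAnalytic a b (F n)) {f g : ℝ → E}
    (hf : TendstoUniformly (fun n (t : ℝ) => F n (t + a * I)) f atTop)
    (hg : TendstoUniformly (fun n (t : ℝ) => F n (t + b * I)) g atTop) :
    ∃ G : ℂ → E, IsStripAnalytic a b G ∧ ∀ t : ℝ, G (t + a * I) = f t ∧ G (t + b * I) = g t := by
  -- The maximum principle, applied to differences, spreads the uniform Cauchy property from the two
  -- boundary lines to the closed strip.
  have hCauchy : ∀ ε > 0, ∃ N, ∀ m ≥ N, ∀ n ≥ N, ∀ z ∈ im ⁻¹' Set.Icc a b,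
      ‖F m z - F n z‖ ≤ ε := by
    intro ε hε
    obtain ⟨N₁, h₁⟩ := eventually_atTop.1 (Metric.tendstoUniformly_iff.1 hf (ε / 2) (by positivity))
    obtain ⟨N₂, h₂⟩ := eventually_atTop.1 (Metric.tendstoUniformly_iff.1 hg (ε / 2) (by positivity))
    refine ⟨max N₁ N₂, fun m hm n hn z hz => ?_⟩
    refine ((hF m).sub (hF n)).norm_le hab (fun t => ?_) (fun t => ?_) hz
    · have e1 := h₁ m (le_of_max_le_left hm) t
      have e2 := h₁ n (le_of_max_le_left hn) t
      rw [Pi.sub_apply, ← dist_eq_norm]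
      have := dist_triangle_left (F m (t + a * I)) (F n (t + a * I)) (f t)
      linarith
    · have e1 := h₂ m (le_of_max_le_right hm) t
      have e2 := h₂ n (le_of_max_le_right hn) t
      rw [Pi.sub_apply, ← dist_eq_norm]
      have := dist_triangle_left (F m (t + b * I)) (F n (t + b * I)) (g t)
      linarith
  have hlim : ∀ z ∈ im ⁻¹' Set.Icc a b, ∃ w, Tendsto (fun n => F n z) atTop (𝓝 w) := by
    intro z hz
    refine cauchySeq_tendsto_of_complete (Metric.cauchySeq_iff'.2 fun ε hε => ?_)
    obtain ⟨N, hN⟩ := hCauchy (ε / 2) (by positivity)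
    exact ⟨N, fun n hn => by
      rw [dist_eq_norm]
      linarith [hN n hn N le_rfl z hz]⟩
  choose! G hG using hlim
  have hunif : TendstoUniformlyOn F G atTop (im ⁻¹' Set.Icc a b) := by
    refine Metric.tendstoUniformlyOn_iff.2 fun ε hε => ?_
    obtain ⟨N, hN⟩ := hCauchy (ε / 2) (by positivity)
    filter_upwards [eventually_ge_atTop N] with n hn z hz
    rw [dist_eq_norm]
    have : ‖G z - F n z‖ ≤ ε / 2 := by
      refine le_of_tendsto ((hG z hz).sub_const (F n z)).norm ?_
      filter_upwards [eventually_ge_atTop N] with m hm using hN m hm n hn z hz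
    linarith
  have hsub : im ⁻¹' Set.Ioo a b ⊆ im ⁻¹' Set.Icc a b := Set.preimage_mono Set.Ioo_subset_Icc_self
  refine ⟨G, ⟨hunif.continuousOn (Eventually.of_forall fun n => (hF n).1).frequently, ?_, ?_⟩,
    fun t => ⟨?_, ?_⟩⟩
  · exact (hunif.mono hsub).tendstoLocallyUniformlyOn.differentiableOn
      (Eventually.of_forall fun n => (hF n).2.1) (isOpen_Ioo.preimage continuous_im)
  · obtain ⟨N, hN⟩ := hCauchy 1 one_pos
    obtain ⟨C, hC⟩ := (hF N).2.2
    refine ⟨1 + C, fun z hz => le_of_tendsto (hG z hz).norm ?_⟩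
    filter_upwards [eventually_ge_atTop N] with m hm
    have := norm_add_le (F m z - F N z) (F N z)
    rw [sub_add_cancel] at this
    linarith [hN m hm N le_rfl z hz, hC z hz]
  · exact tendsto_nhds_unique (hG _ (by simp [hab.le])) (hf.tendsto_at t)
  · exact tendsto_nhds_unique (hG _ (by simp [hab.le])) (hg.tendsto_at t)

end Strip

/-! ### The graph of `A`: closedness and the lower bound for `1 + A` -/

section Generator

variable {K : Type*} [NormedAddCommGroup K] [InnerProductSpace ℂ K]

theorem IsStripAnalytic.comp_add_ofReal {a b : ℝ} {F : ℂ → K} (hF : IsStripAnalytic a b F)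
    (s : ℝ) : IsStripAnalytic a b (fun z => F (z + s)) := by
  obtain ⟨h1, h2, C, h3⟩ := hF
  have hd : DifferentiableOn ℂ (fun z : ℂ => z + s) Set.univ := by fun_prop
  refine ⟨h1.comp (hd.continuousOn.mono (Set.subset_univ _)) ?_,
    h2.comp (hd.mono (Set.subset_univ _)) ?_, C, ?_⟩
  · intro w hw; simpa using hw
  · intro w hw; simpa using hw
  · intro w hw; exact h3 _ (by simpa using hw)

/-- An analytic continuation of an orbit is covariant under translations. -/
theorem IsStripAnalytic.apply_add_ofReal {b : ℝ} (hb : 0 < b) {V : IsometricRep ℂ K} {F : ℂ → K}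
    {x : K} (hF : IsStripAnalytic (-b) 0 F) (hFt : ∀ t : ℝ, F t = V t x) (s : ℝ) {z : ℂ}
    (hz : z ∈ im ⁻¹' Set.Icc (-b) 0) : F (z + s) = V s (F z) := by
  have h2 := (hF.comp_add_ofReal s).sub (hF.clm_comp (V s).toContinuousLinearMap)
  have := h2.eq_zero hb (fun t => by
    simp only [Pi.sub_apply, hFt, LinearIsometry.coe_toContinuousLinearMap]
    rw [← ofReal_add, hFt, ← V.add_apply, add_comm, sub_self]) hz
  simpa [sub_eq_zero] using this

/-- By translation covariance the single value at `-i` determines the whole lower boundary line. In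
this form both boundary values are orbits, which is what limits and reflections need. -/
theorem mem_generatorGraph {V : IsometricRep ℂ K} {p : K × K} : p ∈ generatorGraph V ↔
    ∃ F : ℂ → K, IsStripAnalytic (-1) 0 F ∧ (∀ t : ℝ, F t = V t p.1) ∧
      ∀ t : ℝ, F (t - I) = V t p.2 := by
  constructor
  · rintro ⟨F, hF, hFt, hFi⟩
    refine ⟨F, hF, hFt, fun t => ?_⟩
    rw [← hFi, ← hF.apply_add_ofReal one_pos hFt t (by simp), neg_add_eq_sub]
  · rintro ⟨F, hF, hFt, hFi⟩
    refine ⟨F, hF, hFt, ?_⟩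
    simpa [V.zero_apply] using hFi 0

theorem IsometricRep.tendstoUniformly_apply (V : IsometricRep ℂ K) {u : ℕ → K} {x : K}
    (hu : Tendsto u atTop (𝓝 x)) :
    TendstoUniformly (fun n t => V t (u n)) (fun t => V t x) atTop := by
  refine Metric.tendstoUniformly_iff.2 fun ε hε => ?_
  filter_upwards [Metric.tendsto_nhds.1 hu ε hε] with n hn t
  rwa [(V t).dist_map, dist_comm]

/-- Because each `V_t` is isometric, convergence of pairs in the graph makes both boundary orbits
converge uniformly in `t`, so the continuations converge on the strip. -/
theorem isClosed_generatorGraph [CompleteSpace K] (V : IsometricRep ℂ K) :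
    IsClosed (generatorGraph V : Set (K × K)) := by
  refine isClosed_of_closure_subset fun p hp => ?_
  obtain ⟨u, hu, hup⟩ := mem_closure_iff_seq_limit.1 hp
  simp only [SetLike.mem_coe, mem_generatorGraph] at hu ⊢
  choose F hF hF0 hF1 using hu
  obtain ⟨G, hG, hGt⟩ := exists_isStripAnalytic_of_tendstoUniformly (by norm_num : (-1 : ℝ) < 0) hF
    (f := fun t => V t p.2) (g := fun t => V t p.1)
    (by
      have := V.tendstoUniformly_apply ((continuous_snd.tendsto p).comp hup)
      convert this using 1
      funext n t
      simp only [Function.comp_apply, ← hF1]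
      congr 1
      push_cast
      ring)
    (by
      have := V.tendstoUniformly_apply ((continuous_fst.tendsto p).comp hup)
      convert this using 1
      funext n t
      simp [hF0])
  refine ⟨G, hG, fun t => ?_, fun t => ?_⟩
  · simpa using (hGt t).2
  · rw [← (hGt t).1]
    congr 1
    push_cast
    ring

theorem generatorGraph_inner_nonneg (V : IsometricRep ℂ K) {p : K × K}
    (hp : p ∈ generatorGraph V) : 0 ≤ (inner ℂ p.1 p.2).re := by
  obtain ⟨v, hv⟩ := generatorGraph_inner V hp
  rw [hv, ofReal_re]
  positivity

/-- Positivity of `A` in `‖y + A y‖² = ‖y‖² + ‖A y‖² + 2 Re ⟨y, A y⟩`. This one estimate gives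
injectivity of `1 + A`, closedness of its range, and boundedness of `A (1 + A)⁻¹`. -/
theorem generatorGraph_norm_le (V : IsometricRep ℂ K) {p : K × K}
    (hp : p ∈ generatorGraph V) : ‖p.1‖ ≤ ‖p.2 + p.1‖ ∧ ‖p.2‖ ≤ ‖p.2 + p.1‖ := by
  have h := generatorGraph_inner_nonneg V hp
  have h2 := norm_add_sq (𝕜 := ℂ) p.1 p.2
  rw [add_comm p.1] at h2
  simp only [RCLike.re_to_complex] at h2
  constructor <;> refine abs_le_of_sq_le_sq' ?_ (norm_nonneg _) |>.2 <;>
    nlinarith [sq_nonneg ‖p.1‖, sq_nonneg ‖p.2‖]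

end Generator

/-! ### Entire vectors -/

section Entire

open MeasureTheory

variable {K : Type*} [NormedAddCommGroup K] [InnerProductSpace ℂ K]

theorem norm_cexp_gaussian (b t : ℝ) (z : ℂ) :
    ‖cexp (-b * (t - z) ^ 2)‖ = Real.exp (-b * (t - z.re) ^ 2) * Real.exp (b * z.im ^ 2) := by
  rw [norm_exp, ← Real.exp_add]
  congr 1
  simp [sq]
  ring

theorem integrable_gaussian_smul (V : IsometricRep ℂ K) {b : ℝ} (hb : 0 < b) (x : K) (z : ℂ) :
    Integrable fun t : ℝ => cexp (-b * (t - z) ^ 2) • V t x := by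
  have h := ((integrable_exp_neg_mul_sq hb).comp_sub_right z.re).mul_const
    (Real.exp (b * z.im ^ 2) * ‖x‖)
  refine h.mono' ?_ (Eventually.of_forall fun t => ?_)
  · exact Continuous.aestronglyMeasurable (by have := V.continuous' x; fun_prop)
  · rw [norm_smul, norm_cexp_gaussian, (V t).norm_map, mul_assoc]

/-- Differentiation under the integral sign: on the unit ball around `z₀` the derivative is
dominated by a linear factor times a Gaussian of half the exponent. -/
theorem differentiableAt_integral_gaussian_smul (V : IsometricRep ℂ K) {b : ℝ} (hb : 0 < b)
    (x : K) (z₀ : ℂ) :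
    DifferentiableAt ℂ (fun z => ∫ t : ℝ, cexp (-b * (t - z) ^ 2) • V t x) z₀ := by
  set Q : ℝ := |z₀.im| + 1
  set B : ℝ → ℝ := fun t => (Real.exp (b + b * Q ^ 2) * ‖x‖ * (2 * b)) *
    (|(t - z₀.re) * Real.exp (-(b / 2) * (t - z₀.re) ^ 2)| +
      (1 + Q) * Real.exp (-(b / 2) * (t - z₀.re) ^ 2)) with hB
  have hBint : Integrable B := by
    refine Integrable.const_mul (Integrable.add ?_ (Integrable.const_mul ?_ _)) _
    · exact (((integrable_mul_exp_neg_mul_sq (half_pos hb)).comp_sub_right z₀.re).abs)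
    · exact (integrable_exp_neg_mul_sq (half_pos hb)).comp_sub_right z₀.re
  have hcont := V.continuous' x
  refine (hasDerivAt_integral_of_dominated_loc_of_deriv_le
    (F' := fun z (t : ℝ) => (cexp (-b * (t - z) ^ 2) * (2 * b * (t - z))) • V t x)
    (bound := B) (Metric.ball_mem_nhds z₀ one_pos) ?_ (integrable_gaussian_smul V hb x z₀) ?_ ?_
    hBint ?_).2.differentiableAt
  · exact Eventually.of_forall fun z => Continuous.aestronglyMeasurable (by fun_prop)
  · exact Continuous.aestronglyMeasurable (by fun_prop)
  · refine Eventually.of_forall fun t z hz => ?_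
    rw [Metric.mem_ball, dist_eq_norm] at hz
    have hre : |z.re - z₀.re| ≤ 1 := by
      rw [← sub_re]; exact (abs_re_le_norm _).trans hz.le
    have him : |z.im - z₀.im| ≤ 1 := by
      rw [← sub_im]; exact (abs_im_le_norm _).trans hz.le
    have hQ : |z.im| ≤ Q := by
      have := abs_add_le (z.im - z₀.im) z₀.im
      rw [sub_add_cancel] at this
      simp only [Q]; linarith
    have hQ2 : z.im ^ 2 ≤ Q ^ 2 := by rw [← sq_abs]; gcongr
    have hn : ‖(t - z : ℂ)‖ ≤ |t - z₀.re| + (1 + Q) := by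
      refine (norm_le_abs_re_add_abs_im _).trans ?_
      have := abs_sub_le t z₀.re z.re
      rw [abs_sub_comm z₀.re] at this
      simp
      linarith
    -- Recentring the Gaussian from `Re z` to `Re z₀` uses `(t - Re z₀)² ≤ 2 (t - Re z)² + 2`; this
    -- is why `b` is halved and `exp b` appears.
    have hsq : -b * (t - z.re) ^ 2 + b * z.im ^ 2 ≤
        (b + b * Q ^ 2) + -(b / 2) * (t - z₀.re) ^ 2 := by
      have h1 : (t - z₀.re) ^ 2 ≤ 2 * (t - z.re) ^ 2 + 2 := by
        have : (z.re - z₀.re) ^ 2 ≤ 1 := by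
          rw [← sq_abs]; exact pow_le_one₀ (abs_nonneg _) hre
        nlinarith [sq_nonneg ((t - z.re) - (z.re - z₀.re))]
      nlinarith
    have hexp := Real.exp_le_exp.2 hsq
    rw [Real.exp_add, Real.exp_add] at hexp
    rw [norm_smul, norm_mul, norm_cexp_gaussian, (V t).norm_map]
    have h2b : ‖(2 * b * (t - z) : ℂ)‖ ≤ 2 * b * (|t - z₀.re| + (1 + Q)) := by
      rw [norm_mul, norm_mul, norm_real, Real.norm_of_nonneg hb.le]
      simp only [RCLike.norm_ofNat]
      gcongr
    calc _ ≤ (Real.exp (b + b * Q ^ 2) * Real.exp (-(b / 2) * (t - z₀.re) ^ 2)) *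
          (2 * b * (|t - z₀.re| + (1 + Q))) * ‖x‖ := by gcongr
      _ = B t := by
        simp only [hB, abs_mul, abs_of_nonneg (Real.exp_pos _).le]
        ring
  · refine Eventually.of_forall fun t z _ => HasDerivAt.smul_const ?_ _
    have h : HasDerivAt (fun z : ℂ => -b * ((t : ℂ) - z) ^ 2) (2 * b * (t - z)) z := by
      have := (((hasDerivAt_id z).const_sub (t : ℂ)).pow 2).const_mul (-b : ℂ)
      refine HasDerivAt.congr_deriv this ?_
      simp only [id, Nat.reduceSub, pow_one]
      push_cast
      ring
    exact h.cexp

/-- The smoothing of `x` along its orbit by a Gaussian. -/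
noncomputable def gaussianSmoothing (V : IsometricRep ℂ K) (b : ℝ) (x : K) (z : ℂ) : K :=
  ((√(Real.pi / b))⁻¹ : ℂ) • ∫ t : ℝ, cexp (-b * (t - z) ^ 2) • V t x

theorem differentiable_gaussianSmoothing (V : IsometricRep ℂ K) {b : ℝ} (hb : 0 < b) (x : K) :
    Differentiable ℂ (gaussianSmoothing V b x) :=
  fun z => (differentiableAt_integral_gaussian_smul V hb x z).const_smul _

/-- The normalization cancels the mass `√(π / b)` of the Gaussian, and only its modulus off the real
axis remains. That the bound sees only `Im z` gives boundedness on horizontal strips. -/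
theorem norm_gaussianSmoothing_le (V : IsometricRep ℂ K) {b : ℝ} (hb : 0 < b) (x : K) (z : ℂ) :
    ‖gaussianSmoothing V b x z‖ ≤ Real.exp (b * z.im ^ 2) * ‖x‖ := by
  have h : ‖∫ t : ℝ, cexp (-b * (t - z) ^ 2) • V t x‖ ≤
      √(Real.pi / b) * (Real.exp (b * z.im ^ 2) * ‖x‖) := by
    refine (norm_integral_le_integral_norm _).trans_eq ?_
    simp only [norm_smul, norm_cexp_gaussian, LinearIsometry.norm_map, mul_assoc]
    rw [integral_mul_const, integral_sub_right_eq_self (fun t => Real.exp (-b * t ^ 2)),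
      integral_gaussian]
  have hpos : 0 < √(Real.pi / b) := Real.sqrt_pos.2 (div_pos Real.pi_pos hb)
  rw [gaussianSmoothing, norm_smul, norm_inv, norm_real, Real.norm_of_nonneg hpos.le]
  rwa [inv_mul_le_iff₀ hpos]

theorem gaussianSmoothing_add_ofReal [CompleteSpace K] (V : IsometricRep ℂ K) {b : ℝ} (hb : 0 < b)
    (x : K) (z : ℂ) (s : ℝ) :
    gaussianSmoothing V b x (z + s) = V s (gaussianSmoothing V b x z) := by
  rw [gaussianSmoothing, gaussianSmoothing, map_smul]
  congr 1
  have := (V s).toContinuousLinearMap.integral_comp_comm (integrable_gaussian_smul V hb x z)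
  simp only [LinearIsometry.coe_toContinuousLinearMap] at this
  rw [← this, ← integral_sub_right_eq_self (fun t : ℝ => V s _) s]
  congr 1
  ext t
  rw [map_smul, ← V.add_apply, add_sub_cancel]
  congr 3
  push_cast
  ring

theorem tendsto_gaussianSmoothing [CompleteSpace K] (V : IsometricRep ℂ K) (x : K) :
    Tendsto (fun n : ℕ => gaussianSmoothing V (((n : ℝ) + 1) ^ 2) x 0) atTop (𝓝 x) := by
  -- Substituting `t = s / (n + 1)` fixes the Gaussian and moves `n` into the orbit, where strong
  -- continuity at `0` and dominated convergence apply.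
  have h1 : ∀ n : ℕ, gaussianSmoothing V (((n : ℝ) + 1) ^ 2) x 0 = ((√Real.pi)⁻¹ : ℂ) •
      ∫ s : ℝ, cexp (-(s : ℂ) ^ 2) • V (((n : ℝ) + 1)⁻¹ * s) x := by
    intro n
    have hn : (0 : ℝ) < (n : ℝ) + 1 := by positivity
    have h := Measure.integral_comp_mul_left
      (fun s : ℝ => cexp (-(s : ℂ) ^ 2) • V (((n : ℝ) + 1)⁻¹ * s) x) ((n : ℝ) + 1)
    rw [abs_of_pos (inv_pos.2 hn)] at h
    have hg : (fun t : ℝ => cexp (-(((((n : ℝ) + 1) * t : ℝ)) : ℂ) ^ 2) •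
        V (((n : ℝ) + 1)⁻¹ * (((n : ℝ) + 1) * t)) x) =
        fun t : ℝ => cexp (-((((n : ℝ) + 1) ^ 2 : ℝ) : ℂ) * ((t : ℂ) - 0) ^ 2) • V t x := by
      ext t
      rw [inv_mul_cancel_left₀ hn.ne']
      congr 2
      push_cast
      ring
    rw [hg] at h
    rw [gaussianSmoothing, h, ← Complex.coe_smul, smul_smul]
    congr 1
    rw [Real.sqrt_div Real.pi_pos.le, Real.sqrt_sq hn.le]
    have h3 : ((√Real.pi : ℝ) : ℂ) ≠ 0 := by
      exact_mod_cast (Real.sqrt_pos.2 Real.pi_pos).ne'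
    have h4 : (((n : ℝ) + 1 : ℝ) : ℂ) ≠ 0 := by exact_mod_cast hn.ne'
    push_cast at h4 ⊢
    field_simp
  have hlim : Tendsto (fun n : ℕ => ∫ s : ℝ, cexp (-(s : ℂ) ^ 2) • V (((n : ℝ) + 1)⁻¹ * s) x) atTop
      (𝓝 (∫ s : ℝ, cexp (-(s : ℂ) ^ 2) • x)) := by
    have hcont := V.continuous' x
    refine tendsto_integral_of_dominated_convergence
      (fun s => Real.exp (-1 * s ^ 2) * ‖x‖) (fun n => ?_) ?_ ?_ ?_
    · exact Continuous.aestronglyMeasurable (by fun_prop)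
    · exact (integrable_exp_neg_mul_sq one_pos).mul_const _
    · refine fun n => Eventually.of_forall fun s => ?_
      rw [norm_smul, (V _).norm_map, norm_exp]
      refine le_of_eq ?_
      congr 2
      rw [← ofReal_pow, ← ofReal_neg, ofReal_re]
      ring
    · refine Eventually.of_forall fun s => Tendsto.const_smul ?_ _
      have h0 : Tendsto (fun n : ℕ => ((n : ℝ) + 1)⁻¹ * s) atTop (𝓝 0) := by
        simpa [one_div] using (tendsto_one_div_add_atTop_nhds_zero_nat (𝕜 := ℝ)).mul_const s
      have := (hcont.tendsto 0).comp h0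
      rwa [V.zero_apply] at this
  have hval : ((√Real.pi)⁻¹ : ℂ) • ∫ s : ℝ, cexp (-(s : ℂ) ^ 2) • x = x := by
    rw [integral_smul_const]
    have h2 : ∫ s : ℝ, cexp (-(s : ℂ) ^ 2) = ((√Real.pi : ℝ) : ℂ) := by
      have := integral_gaussian 1
      simp only [div_one] at this
      rw [← this, ← integral_complex_ofReal]
      congr 1
      ext s
      push_cast
      ring_nf
    have h3 : ((√Real.pi : ℝ) : ℂ) ≠ 0 := by
      exact_mod_cast (Real.sqrt_pos.2 Real.pi_pos).ne'
    rw [h2, smul_smul, inv_mul_cancel₀ h3, one_smul]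
  have := hlim.const_smul ((√Real.pi)⁻¹ : ℂ)
  rw [hval] at this
  simpa only [h1] using this

/-- The smoothing `G` is entire and real translations act on it through `V`, so `w ↦ G(w + z)`
continues the orbit of `G(z)`: `A G(z) = G(z - i)`. -/
theorem gaussianSmoothing_mem_generatorGraph [CompleteSpace K] (V : IsometricRep ℂ K) {b : ℝ}
    (hb : 0 < b) (x : K) (z : ℂ) :
    (gaussianSmoothing V b x z, gaussianSmoothing V b x (z - I)) ∈ generatorGraph V := by
  have hd := differentiable_gaussianSmoothing V hb x
  refine ⟨fun w => gaussianSmoothing V b x (w + z), ⟨?_, ?_, ?_⟩, fun t => ?_, ?_⟩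
  · exact (hd.continuous.comp (continuous_add_const z)).continuousOn
  · exact (hd.comp (differentiable_id.add_const z)).differentiableOn
  · refine ⟨Real.exp (b * (1 + |z.im|) ^ 2) * ‖x‖, fun w hw => ?_⟩
    refine (norm_gaussianSmoothing_le V hb x _).trans ?_
    have : (w + z).im ^ 2 ≤ (1 + |z.im|) ^ 2 := by
      rw [← sq_abs]
      have h1 : |w.im| ≤ 1 := abs_le.2 ⟨hw.1, hw.2.trans zero_le_one⟩
      have h2 := abs_add_le w.im z.im
      rw [add_im]
      gcongr
      linarith
    gcongr
  · beta_reduce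
    rw [add_comm, gaussianSmoothing_add_ofReal V hb]
  · simp only [neg_add_eq_sub]

/-- The vectors `(1 + A) y` are dense. -/
theorem dense_range_one_add_generator [CompleteSpace K] (V : IsometricRep ℂ K) :
    Dense (((generatorGraph V).map (LinearMap.snd ℂ K K + LinearMap.fst ℂ K K) :
      Submodule ℂ K) : Set K) := by
  rw [Submodule.dense_iff_topologicalClosure_eq_top, Submodule.topologicalClosure_eq_top_iff,
    Submodule.eq_bot_iff]
  intro w hw
  rw [Submodule.mem_orthogonal'] at hw
  have key : ∀ (b : ℝ), 0 < b → ∀ x, inner ℂ w (gaussianSmoothing V b x 0) = 0 := by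
    intro b hb x
    set f : ℂ → ℂ := fun z => innerSL ℂ w (gaussianSmoothing V b x z) with hf
    have hfd : Differentiable ℂ f :=
      (innerSL ℂ w).differentiable.comp (differentiable_gaussianSmoothing V hb x)
    -- Orthogonality of `w` to `(1 + A) G(z) = G(z - i) + G(z)`. Hence `f` has period `2i` and is
    -- bounded; Liouville makes it constant, and a constant equal to its negative is `0`.
    have hanti : ∀ z, f (z - I) = - f z := by
      intro z
      have := hw _ ⟨_, gaussianSmoothing_mem_generatorGraph V hb x z, rfl⟩
      simp only [LinearMap.add_apply, LinearMap.snd_apply, LinearMap.fst_apply,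
        inner_add_right] at this
      exact eq_neg_of_add_eq_zero_left this
    have hper : Function.Periodic f (2 * I) := by
      intro z
      have h1 := hanti (z + 2 * I)
      have h2 := hanti (z + I)
      rw [show z + 2 * I - I = z + I by ring] at h1
      rw [show z + I - I = z by ring] at h2
      rw [h2, h1, neg_neg]
    have hbdd : Bornology.IsBounded (Set.range f) := by
      refine isBounded_iff_forall_norm_le.2
        ⟨‖innerSL ℂ w‖ * (Real.exp (b * 2 ^ 2) * ‖x‖), ?_⟩
      rintro _ ⟨z, rfl⟩
      rw [← hper.sub_int_mul_eq ⌊z.im / 2⌋]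
      refine ((innerSL ℂ w).le_opNorm _).trans
        (mul_le_mul_of_nonneg_left ((norm_gaussianSmoothing_le V hb x _).trans ?_) (norm_nonneg _))
      have h1 := Int.floor_le (z.im / 2)
      have h2 := Int.lt_floor_add_one (z.im / 2)
      have h3 : (z - (⌊z.im / 2⌋ : ℂ) * (2 * I)).im = z.im - 2 * ⌊z.im / 2⌋ := by
        simp
        ring
      rw [h3]
      have h4 : (z.im - 2 * ⌊z.im / 2⌋) ^ 2 ≤ 2 ^ 2 := by
        refine pow_le_pow_left₀ ?_ ?_ 2 <;> linarith
      gcongr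
    have h0 := hfd.apply_eq_apply_of_bounded hbdd (0 - I) 0
    rw [hanti] at h0
    exact self_eq_neg.1 h0.symm
  have : Tendsto (fun n : ℕ => inner ℂ w (gaussianSmoothing V (((n : ℝ) + 1) ^ 2) w 0)) atTop
      (𝓝 (inner ℂ w w)) := tendsto_const_nhds.inner (tendsto_gaussianSmoothing V w)
  simp only [fun n : ℕ => key (((n : ℝ) + 1) ^ 2) (by positivity) w] at this
  exact inner_self_eq_zero.1 (tendsto_nhds_unique tendsto_const_nhds this).symm

/-- `A` is self-adjoint: `1 + A` is onto. -/
theorem exists_mem_generatorGraph_add_eq [CompleteSpace K] (V : IsometricRep ℂ K) (x : K) :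
    ∃ p ∈ generatorGraph V, p.2 + p.1 = x := by
  obtain ⟨u, hu, hux⟩ := mem_closure_iff_seq_limit.1 (dense_range_one_add_generator V x)
  choose p hp hpu using hu
  simp only [LinearMap.add_apply, LinearMap.snd_apply, LinearMap.fst_apply] at hpu
  -- By `generatorGraph_norm_le`, the pairs `(y, A y)` are Cauchy as soon as the vectors `(1 + A) y`
  -- are; this closes the range of `1 + A`.
  have hc : CauchySeq p := by
    refine Metric.cauchySeq_iff.2 fun ε hε => ?_
    obtain ⟨N, hN⟩ := Metric.cauchySeq_iff.1 hux.cauchySeq ε hε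
    refine ⟨N, fun m hm n hn => lt_of_le_of_lt ?_ (hN m hm n hn)⟩
    have h := generatorGraph_norm_le V ((generatorGraph V).sub_mem (hp m) (hp n))
    have e : (p m - p n).2 + (p m - p n).1 = u m - u n := by
      rw [← hpu, ← hpu, Prod.snd_sub, Prod.fst_sub]
      abel
    rw [e] at h
    rw [dist_eq_norm, dist_eq_norm, Prod.norm_def]
    exact max_le h.1 h.2
  obtain ⟨q, hq⟩ := cauchySeq_tendsto_of_complete hc
  refine ⟨q, (isClosed_generatorGraph V).mem_of_tendsto hq (Eventually.of_forall hp), ?_⟩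
  refine tendsto_nhds_unique ?_ hux
  have := ((continuous_snd.add continuous_fst).tendsto q).comp hq
  exact this.congr hpu

theorem generatorGraph_unique {V : IsometricRep ℂ K} {p q : K × K} (hp : p ∈ generatorGraph V)
    (hq : q ∈ generatorGraph V) (h : p.2 + p.1 = q.2 + q.1) : p = q := by
  have hd := generatorGraph_norm_le V ((generatorGraph V).sub_mem hp hq)
  have e : (p - q).2 + (p - q).1 = 0 := by
    rw [Prod.snd_sub, Prod.fst_sub, sub_add_sub_comm, h, sub_self]
  rw [e, norm_zero, norm_le_zero_iff, norm_le_zero_iff] at hd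
  exact sub_eq_zero.1 (Prod.ext hd.1 hd.2)

/-- Solve `(1 + A) y = 2 x` and put `T x = A y`. Uniqueness of the solution makes `T` linear, and
`‖A y‖ ≤ ‖(1 + A) y‖ = 2 ‖x‖` makes it bounded. -/
theorem exists_isTwoDivOneAddInv [CompleteSpace K] (V : IsometricRep ℂ K) :
    ∃ T, IsTwoDivOneAddInv V T := by
  choose p hp hpx using fun x => exists_mem_generatorGraph_add_eq V ((2 : ℂ) • x)
  let T : K →ₗ[ℂ] K :=
    { toFun := fun x => (p x).2
      map_add' := fun x y => by
        rw [← Prod.snd_add]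
        refine congrArg _ (generatorGraph_unique (hp _) ((generatorGraph V).add_mem (hp _) (hp _)) ?_)
        rw [hpx, Prod.snd_add, Prod.fst_add, add_add_add_comm, hpx, hpx, smul_add]
      map_smul' := fun c x => by
        rw [RingHom.id_apply, ← Prod.smul_snd]
        refine congrArg _ (generatorGraph_unique (hp _) ((generatorGraph V).smul_mem c (hp _)) ?_)
        rw [hpx, Prod.smul_snd, Prod.smul_fst, ← smul_add, hpx, smul_comm] }
  refine ⟨T.mkContinuous 2 fun x => ?_, fun x => ⟨(p x).1, hp x, hpx x⟩⟩
  refine (generatorGraph_norm_le V (hp x)).2.trans_eq ?_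
  rw [hpx, norm_smul]
  simp

theorem isTwoDivOneAddInv_twoDivOneAddInv [CompleteSpace K] (V : IsometricRep ℂ K) :
    IsTwoDivOneAddInv V (twoDivOneAddInv V) := by
  have h := exists_isTwoDivOneAddInv V
  rw [twoDivOneAddInv, dif_pos h]
  exact h.choose_spec

theorem twoDivOneAddInv_mem [CompleteSpace K] (V : IsometricRep ℂ K) (x : K) :
    ((2 : ℂ) • x - twoDivOneAddInv V x, twoDivOneAddInv V x) ∈ generatorGraph V := by
  obtain ⟨y, hy, hxy⟩ := isTwoDivOneAddInv_twoDivOneAddInv V x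
  rwa [← hxy, add_sub_cancel_left]

/-- The vector `(2 - T) x` is `A⁻¹ T x`. If it vanishes, the continuation of its orbit vanishes on
the strip, so `T x = 0` and then `2 x = 0`. -/
theorem two_sub_twoDivOneAddInv_injective [CompleteSpace K] (V : IsometricRep ℂ K) {x : K}
    (hx : (2 : ℂ) • x - twoDivOneAddInv V x = 0) : x = 0 := by
  have h := twoDivOneAddInv_mem V x
  rw [hx] at h
  obtain ⟨F, hF, hF0, hF1⟩ := h
  have h0 := hF.eq_zero one_pos (fun t => by rw [hF0, map_zero]) (z := -I) (by simp)
  rw [hF1] at h0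
  change twoDivOneAddInv V x = 0 at h0
  rw [h0, sub_zero] at hx
  simpa using hx

end Entire

/-! ### Shifts, reflections and products of strip-analytic functions -/

section Strip

variable {E F : Type*} [NormedAddCommGroup E] [InnerProductSpace ℂ E]
  [NormedAddCommGroup F] [InnerProductSpace ℂ F]

/-- Passes from the strip on which `A` is defined to the strip of the KMS condition. -/
theorem IsStripAnalytic.sub_I {f : ℂ → E} (hf : IsStripAnalytic (-1) 0 f) :
    IsStripAnalytic 0 1 fun z => f (z - I) := by
  obtain ⟨h1, h2, C, h3⟩ := hf
  have hm : ∀ w : ℂ, (w - I).im = w.im - 1 := fun w => by simp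
  refine ⟨h1.comp (by fun_prop) ?_, h2.comp (by fun_prop) ?_, C, fun z hz => h3 _ ?_⟩
  · intro w hw
    simp only [Set.mem_preimage, Set.mem_Icc, hm] at hw ⊢
    constructor <;> linarith
  · intro w hw
    simp only [Set.mem_preimage, Set.mem_Ioo, hm] at hw ⊢
    constructor <;> linarith
  · simp only [Set.mem_preimage, Set.mem_Icc, hm] at hz ⊢
    constructor <;> linarith

/-- Reflection of a strip-analytic function by a conjugate-linear map. -/
theorem IsStripAnalytic.conj_sub_I {f : ℂ → E} (hf : IsStripAnalytic (-1) 0 f) (L : E →L⋆[ℂ] F) :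
    IsStripAnalytic (-1) 0 fun z => L (f (conj z - I)) := by
  obtain ⟨h1, h2, C, h3⟩ := hf
  have hm : ∀ w : ℂ, (conj w - I).im = -w.im - 1 := fun w => by simp
  have hc : Continuous fun w : ℂ => conj w - I := continuous_conj.sub continuous_const
  refine ⟨L.continuous.comp_continuousOn (h1.comp hc.continuousOn ?_), fun w hw => ?_, ‖L‖ * C,
    fun z hz => (L.le_opNorm _).trans (mul_le_mul_of_nonneg_left (h3 _ ?_) (norm_nonneg _))⟩
  · intro w hw
    simp only [Set.mem_preimage, Set.mem_Icc, hm] at hw ⊢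
    constructor <;> linarith
  · have hopen : IsOpen (im ⁻¹' Set.Ioo (-1 : ℝ) 0) := isOpen_Ioo.preimage continuous_im
    have hw' : conj w - I ∈ im ⁻¹' Set.Ioo (-1 : ℝ) 0 := by
      simp only [Set.mem_preimage, Set.mem_Ioo, hm] at hw ⊢
      constructor <;> linarith
    have hd : DifferentiableAt ℂ (fun z => f (z - I)) (conj w) :=
      (h2.differentiableAt (hopen.mem_nhds hw')).comp (conj w) (by fun_prop)
    -- The two antilinear maps, `L` outside and conjugation inside, compose to a complex linear
    -- derivative.
    exact (DifferentiableAt.comp_semilinear₂ L (starL ℂ : ℂ ≃L⋆[ℂ] ℂ).toContinuousLinearMap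
      hd).differentiableWithinAt
  · simp only [Set.mem_preimage, Set.mem_Icc, hm] at hz ⊢
    constructor <;> linarith

theorem IsStripAnalytic.mul {a b : ℝ} {f g : ℂ → ℂ} (hf : IsStripAnalytic a b f)
    (hg : IsStripAnalytic a b g) : IsStripAnalytic a b (fun z => f z * g z) := by
  obtain ⟨h1, h2, C, h3⟩ := hf
  obtain ⟨k1, k2, D, k3⟩ := hg
  refine ⟨h1.mul k1, h2.mul k2, C * D, fun z hz => ?_⟩
  rw [norm_mul]
  exact mul_le_mul (h3 z hz) (k3 z hz) (norm_nonneg _) ((norm_nonneg _).trans (h3 z hz))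

theorem IsStripAnalytic.const (a b : ℝ) (c : E) : IsStripAnalytic a b (fun _ => c) :=
  ⟨continuousOn_const, differentiableOn_const _, ‖c‖, fun _ _ => le_rfl⟩

end Strip

/-! ### Weak convergence tested on total sets -/

section WeakLimits

variable {E ι : Type*} [NormedAddCommGroup E] [InnerProductSpace ℂ E]

/-- Weak convergence of a bounded family can be tested on a total set. -/
theorem tendsto_inner_zero_of_dense_span {l : Filter ι} {w : ι → E} {C : ℝ} (hw : ∀ t, ‖w t‖ ≤ C)
    {S : Set E} (hS : Dense (Submodule.span ℂ S : Set E))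
    (h : ∀ u ∈ S, Tendsto (fun t => inner ℂ u (w t)) l (𝓝 0)) (u : E) :
    Tendsto (fun t => inner ℂ u (w t)) l (𝓝 0) := by
  have hspan : ∀ u ∈ Submodule.span ℂ S, Tendsto (fun t => inner ℂ u (w t)) l (𝓝 0) := by
    intro u hu
    induction hu using Submodule.span_induction with
    | mem x hx => exact h x hx
    | zero => simp [tendsto_const_nhds]
    | add x y _ _ hx hy => simpa [inner_add_left] using hx.add hy
    | smul a x _ hx => simpa [inner_smul_left] using hx.mul_const (conj a)
  rw [Metric.tendsto_nhds]
  intro ε hε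
  obtain ⟨u', hu', hd⟩ := Metric.dense_iff.1 hS u (ε / (2 * (|C| + 1))) (by positivity)
  rw [Metric.mem_ball, dist_eq_norm] at hu'
  filter_upwards [Metric.tendsto_nhds.1 (hspan u' hd) (ε / 2) (by positivity)] with t ht
  rw [dist_zero_right] at ht ⊢
  have h1 : inner ℂ u (w t) = inner ℂ u' (w t) - inner ℂ (u' - u) (w t) := by
    rw [inner_sub_left]; ring
  have h2 : ‖inner ℂ (u' - u) (w t)‖ ≤ ε / (2 * (|C| + 1)) * (|C| + 1) :=
    (norm_inner_le_norm _ _).trans (mul_le_mul hu'.le (by linarith [hw t, le_abs_self C])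
      (norm_nonneg _) (by positivity))
  have h3 : ε / (2 * (|C| + 1)) * (|C| + 1) = ε / 2 := by
    have : |C| + 1 ≠ 0 := by positivity
    field_simp
  rw [h1]
  have := norm_sub_le (inner ℂ u' (w t)) (inner ℂ (u' - u) (w t))
  linarith

/-- Weak operator convergence of isometries can be tested on a total set. -/
theorem tendsto_inner_of_dense_span [CompleteSpace E] {l : Filter ι} (V : ι → E →ₗᵢ[ℂ] E)
    (P : E →L[ℂ] E) {S : Set E} (hS : Dense (Submodule.span ℂ S : Set E))
    (h : ∀ u ∈ S, ∀ v ∈ S, Tendsto (fun t => inner ℂ u (V t v)) l (𝓝 (inner ℂ u (P v)))) (u v : E) :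
    Tendsto (fun t => inner ℂ u (V t v)) l (𝓝 (inner ℂ u (P v))) := by
  set A : ι → E →L[ℂ] E := fun t => (V t).toContinuousLinearMap - P
  have hA : ∀ t, ‖A t‖ ≤ 1 + ‖P‖ := fun t =>
    (norm_sub_le _ _).trans (add_le_add_left (V t).norm_toContinuousLinearMap_le _)
  have hiff : ∀ u v, Tendsto (fun t => inner ℂ u (V t v)) l (𝓝 (inner ℂ u (P v))) ↔
      Tendsto (fun t => inner ℂ u (A t v)) l (𝓝 0) := by
    intro u v
    rw [← tendsto_sub_nhds_zero_iff]
    simp only [A, sub_apply, inner_sub_right,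
      LinearIsometry.coe_toContinuousLinearMap]
  rw [hiff]
  -- The two slots are extended in turn: the left one with `v ∈ S` fixed, then the right one through
  -- the adjoints, which obey the same norm bound.
  have h1 : ∀ v ∈ S, ∀ u, Tendsto (fun t => inner ℂ u (A t v)) l (𝓝 0) := fun v hv u =>
    tendsto_inner_zero_of_dense_span (C := (1 + ‖P‖) * ‖v‖)
      (fun t => (A t).le_of_opNorm_le (hA t) v) hS (fun u hu => (hiff u v).1 (h u hu v hv)) u
  have h2 := tendsto_inner_zero_of_dense_span (l := l)
    (w := fun t => ContinuousLinearMap.adjoint (A t) u) (C := (1 + ‖P‖) * ‖u‖)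
    (fun t => (ContinuousLinearMap.adjoint (A t)).le_of_opNorm_le
      (by rw [LinearIsometryEquiv.norm_map]; exact hA t) u) hS (fun v hv => by
      have := (continuous_conj.tendsto _).comp (h1 v hv u)
      rw [map_zero] at this
      refine this.congr fun t => ?_
      rw [Function.comp_apply, inner_conj_symm, ContinuousLinearMap.adjoint_inner_right]) v
  have h3 := (continuous_conj.tendsto _).comp h2
  rw [map_zero] at h3
  refine h3.congr fun t => ?_
  rw [Function.comp_apply, inner_conj_symm, ContinuousLinearMap.adjoint_inner_left]

end WeakLimits

/-! ### The conjugation of `H_ℂ` -/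

namespace Complexification

variable {H : Type*} [NormedAddCommGroup H] [InnerProductSpace ℝ H]

/-- The complex conjugation `x + i y ↦ x - i y` of `H_ℂ`. -/
noncomputable def conjugation : Complexification H →L⋆[ℂ] Complexification H :=
  LinearMap.mkContinuous
    { toFun := fun z => mk z.re (-z.im)
      map_add' := fun z w => by ext <;> simp [add_comm]
      map_smul' := fun c z => by
        ext
        · simp
        · simp [add_comm] } 1 fun z => by
    refine abs_le_of_sq_le_sq' (le_of_eq ?_) (by positivity) |>.2
    rw [one_mul, norm_sq, norm_sq]
    simp

@[simp] theorem conjugation_re (z : Complexification H) : (conjugation z).re = z.re := rfl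
@[simp] theorem conjugation_im (z : Complexification H) : (conjugation z).im = -z.im := rfl

@[simp] theorem conjugation_conjugation (z : Complexification H) :
    conjugation (conjugation z) = z := by ext <;> simp

@[simp] theorem conjugation_mk_zero (x : H) : conjugation (mk x 0) = mk x 0 := by ext <;> simp

theorem inner_conjugation_left (z w : Complexification H) :
    inner ℂ (conjugation z) w = inner ℂ (conjugation w) z := by
  rw [inner_def, inner_def]
  apply Complex.ext
  · simp [real_inner_comm]
  · simp only [conjugation_re, conjugation_im, inner_neg_left, real_inner_comm]
    ring

theorem inner_conjugation_right (z w : Complexification H) :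
    inner ℂ z (conjugation w) = inner ℂ w (conjugation z) := by
  rw [← inner_conj_symm, inner_conjugation_left, inner_conj_symm]

theorem conjugation_complexify (U : IsometricRep ℝ H) (t : ℝ) (z : Complexification H) :
    conjugation (U.complexify t z) = U.complexify t (conjugation z) := by
  ext
  · rfl
  · exact (map_neg (U t) z.im).symm

theorem mk_add_I_smul_mk (z : Complexification H) : mk z.re 0 + I • mk z.im 0 = z := by
  ext <;> simp

end Complexification

/-! ### The one-particle space: `J T J = 2 - T` and its consequences -/

section OneParticle

open Complexification

variable {H : Type*} [NormedAddCommGroup H] [InnerProductSpace ℝ H] [CompleteSpace H]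
  (U : IsometricRep ℝ H)

/-- This is `J A J = A⁻¹`. The reflection `z ↦ conj z - i` exchanges the boundary lines of the
strip, and `J` restores holomorphy while commuting with `U_t`. -/
theorem conjugation_mem_generatorGraph {p : Complexification H × Complexification H}
    (hp : p ∈ generatorGraph U.complexify) :
    (conjugation p.2, conjugation p.1) ∈ generatorGraph U.complexify := by
  obtain ⟨F, hF, hF0, hF1⟩ := mem_generatorGraph.1 hp
  refine ⟨fun z => conjugation (F (conj z - I)), hF.conj_sub_I _, fun t => ?_, ?_⟩
  · beta_reduce
    rw [conj_ofReal, hF1, conjugation_complexify]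
  · have : conj (-I) - I = ((0 : ℝ) : ℂ) := by simp
    beta_reduce
    rw [this, hF0, IsometricRep.zero_apply]

/-- `J T J = 2 - T`, since `J A J = A⁻¹`. -/
theorem twoDivOneAddInv_conjugation (x : Complexification H) :
    twoDivOneAddInv U.complexify (conjugation x) =
      conjugation ((2 : ℂ) • x - twoDivOneAddInv U.complexify x) := by
  have h1 := conjugation_mem_generatorGraph U (twoDivOneAddInv_mem U.complexify x)
  have h2 := twoDivOneAddInv_mem U.complexify (conjugation x)
  refine congrArg Prod.snd (generatorGraph_unique h2 h1 ?_)
  simp only [map_sub, map_smulₛₗ, map_ofNat]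
  abel

theorem inner_twoDivOneAddInv_left (x y : Complexification H) :
    inner ℂ (twoDivOneAddInv U.complexify x) y = inner ℂ x (twoDivOneAddInv U.complexify y) :=
  twoDivOneAddInv_isSymmetric U.complexify x y

theorem inner_realInclusion (x y : H) : inner ℂ (realInclusion U x) (realInclusion U y) =
    inner ℂ (twoDivOneAddInv U.complexify (mk x 0)) (mk y 0) := by
  rw [realInclusion, realInclusion, UniformSpace.Completion.inner_coe, PreOneParticle.inner_def]
  simp

/-- The KMS condition for the one-particle space. -/
theorem exists_isStripAnalytic_inner_realInclusion (x y : H) : ∃ f : ℂ → ℂ, IsStripAnalytic 0 1 f ∧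
    ∀ t : ℝ, f t = inner ℂ (realInclusion U x) (oneParticleRep U t (realInclusion U y)) ∧
      f (t + I) = inner ℂ (oneParticleRep U t (realInclusion U y)) (realInclusion U x) := by
  -- `F` continues the orbit of `(2 - T) y = A⁻¹ T y` and carries the orbit of `T y` at height `-1`.
  -- After the shift, `T y` sits on the real axis and `(2 - T) y` at height `1`.
  obtain ⟨F, hF, hF0, hF1⟩ := mem_generatorGraph.1 (twoDivOneAddInv_mem U.complexify (mk y 0))
  have hmk : ∀ t, U.complexify t (mk y 0) = mk (U t y) 0 := fun t => by
    change mk (U t y) (U t 0) = _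
    rw [map_zero]
  refine ⟨fun z => innerSL ℂ (mk x 0) (F (z - I)), hF.sub_I.clm_comp _, fun t => ⟨?_, ?_⟩⟩
  · beta_reduce
    rw [hF1, oneParticleRep_realInclusion, inner_realInclusion, innerSL_apply_apply,
      inner_twoDivOneAddInv_left, ← hmk, twoDivOneAddInv_comm]
  -- For real `x` and `z = U_t y`, `J T J = 2 - T` turns `⟨x, (2 - T) z⟩` into `⟨x, J T z⟩ = ⟨T z,
  -- x⟩`.
  · beta_reduce
    rw [add_sub_cancel_right, hF0, oneParticleRep_realInclusion, inner_realInclusion,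
      innerSL_apply_apply, ← hmk, map_sub, map_smul, ← twoDivOneAddInv_comm, hmk,
      ← conjugation_conjugation ((2 : ℂ) • mk (U t y) 0 - _), ← twoDivOneAddInv_conjugation,
      conjugation_mk_zero, inner_conjugation_right, conjugation_mk_zero]

/-- Conjugating `⟨T x, y⟩` for real `x`, `y` replaces `T` by `J T J = 2 - T`, so twice the real part
is `2 ⟨x, y⟩`. This is how mixing on `H` comes back to `H_ℝ`. -/
theorem inner_realInclusion_re (x y : H) :
    (inner ℂ (realInclusion U x) (realInclusion U y)).re = inner ℝ x y := by
  have h2 : conj (inner ℂ (realInclusion U x) (realInclusion U y)) =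
      2 * inner ℂ (mk x 0) (mk y 0) - inner ℂ (realInclusion U x) (realInclusion U y) := by
    rw [inner_conj_symm, inner_realInclusion, inner_realInclusion, inner_twoDivOneAddInv_left]
    conv_lhs => rw [← conjugation_mk_zero x, twoDivOneAddInv_conjugation, inner_conjugation_right]
    rw [conjugation_mk_zero, inner_sub_left, inner_smul_left, map_ofNat]
  have h3 := congrArg Complex.re h2
  rw [conj_re, inner_def] at h3
  simp at h3
  linarith

theorem norm_toPreOneParticle_le (z : Complexification H) : ‖toPreOneParticle U z‖ ≤
    √(‖twoDivOneAddInv U.complexify‖) * ‖z‖ := by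
  refine abs_le_of_sq_le_sq' ?_ (by positivity) |>.2
  rw [mul_pow, Real.sq_sqrt (norm_nonneg _), norm_sq_eq_re_inner (𝕜 := ℂ), PreOneParticle.inner_def]
  simp only [LinearEquiv.symm_apply_apply]
  refine (RCLike.re_le_norm _).trans ((norm_inner_le_norm _ _).trans ?_)
  rw [sq, ← mul_assoc]
  exact mul_le_mul_of_nonneg_right (ContinuousLinearMap.le_opNorm _ _) (norm_nonneg _)

/-- The inclusion `H_ℂ ⊆ H`. -/
noncomputable def complexInclusion : Complexification H →L[ℂ] OneParticle U :=
  UniformSpace.Completion.toComplL.comp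
    ((toPreOneParticle U).toLinearMap.mkContinuous _ (norm_toPreOneParticle_le U))

theorem complexInclusion_apply (z : Complexification H) :
    complexInclusion U z = ((toPreOneParticle U z : PreOneParticle U) : OneParticle U) := rfl

theorem complexInclusion_mk_zero (x : H) : complexInclusion U (mk x 0) = realInclusion U x := rfl

theorem denseRange_complexInclusion : DenseRange (complexInclusion U) :=
  UniformSpace.Completion.denseRange_coe.comp (toPreOneParticle U).surjective.denseRange
    (UniformSpace.Completion.continuous_coe _)

theorem inner_complexInclusion (z w : Complexification H) :
    inner ℂ (complexInclusion U z) (complexInclusion U w) =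
      inner ℂ (twoDivOneAddInv U.complexify z) w := by
  rw [complexInclusion_apply, complexInclusion_apply, UniformSpace.Completion.inner_coe,
    PreOneParticle.inner_def]
  simp

/-- The pairs `(a, b)` such that `r(a) + r(b)^*` commutes with the free Araki--Woods algebra. -/
def IsCommutantPair (a b : OneParticle U) : Prop :=
  ∀ x : H, inner ℂ (realInclusion U x) a = inner ℂ b (realInclusion U x)

/-- For real `x` both sides equal `⟨x, T (2 - T) z⟩`: on the left `T` comes from the inner product,
on the right `T J T z = J (2 - T) T z`. -/
theorem isCommutantPair_complexInclusion (z : Complexification H) :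
    IsCommutantPair U (complexInclusion U ((2 : ℂ) • z - twoDivOneAddInv U.complexify z))
      (complexInclusion U (conjugation (twoDivOneAddInv U.complexify z))) := by
  intro x
  rw [← complexInclusion_mk_zero, inner_complexInclusion, inner_complexInclusion,
    twoDivOneAddInv_conjugation, inner_conjugation_left, conjugation_mk_zero,
    inner_twoDivOneAddInv_left, map_sub, map_smul]

/-- The set contains the image of `2 - T`, which is symmetric and injective and therefore has dense
range in `H_ℂ`, itself dense in `H`. -/
theorem dense_setOf_isCommutantPair : Dense {a | ∃ b, IsCommutantPair U a b} := by
  set T := twoDivOneAddInv U.complexify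
  set R : Complexification H →L[ℂ] Complexification H := (2 : ℂ) • .id ℂ _ - T with hR
  have hsymm : (R : Complexification H →ₗ[ℂ] Complexification H).IsSymmetric := by
    intro x y
    change inner ℂ ((2 : ℂ) • x - T x) y = inner ℂ x ((2 : ℂ) • y - T y)
    rw [inner_sub_left, inner_sub_right, inner_twoDivOneAddInv_left, inner_smul_left,
      inner_smul_right, map_ofNat]
  have hdense : DenseRange R := by
    change Dense (((R : Complexification H →ₗ[ℂ] Complexification H).range :
      Submodule ℂ (Complexification H)) : Set (Complexification H))
    rw [Submodule.dense_iff_topologicalClosure_eq_top, Submodule.topologicalClosure_eq_top_iff,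
      hsymm.orthogonal_range, LinearMap.ker_eq_bot']
    exact fun z hz => two_sub_twoDivOneAddInv_injective U.complexify hz
  refine ((denseRange_complexInclusion U).comp hdense (complexInclusion U).continuous).mono ?_
  rintro _ ⟨z, rfl⟩
  exact ⟨_, isCommutantPair_complexInclusion U z⟩

theorem dense_span_range_realInclusion :
    Dense (Submodule.span ℂ (Set.range (realInclusion U)) : Set (OneParticle U)) := by
  refine (denseRange_complexInclusion U).mono ?_
  rintro _ ⟨z, rfl⟩
  rw [← mk_add_I_smul_mk z, map_add, map_smul, complexInclusion_mk_zero, complexInclusion_mk_zero]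
  exact add_mem (Submodule.subset_span ⟨_, rfl⟩)
    (Submodule.smul_mem _ _ (Submodule.subset_span ⟨_, rfl⟩))

theorem isMixing_of_oneParticle (h : ∀ x y : H, Tendsto (fun t => inner ℂ (realInclusion U x)
    (oneParticleRep U t (realInclusion U y))) (cocompact ℝ) (𝓝 0)) : U.IsMixing := by
  intro x y
  have := (continuous_re.tendsto _).comp (h y x)
  refine this.congr fun t => ?_
  rw [Function.comp_apply, oneParticleRep_realInclusion, inner_realInclusion_re, real_inner_comm]

/-- For real vectors `⟨x, U_t y⟩_U = ⟨T x, U_t y⟩` is an ordinary coefficient in `H_ℂ`, a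
combination of coefficients on `H_ℝ`; real vectors are total in `H`. -/
theorem tendsto_inner_oneParticleRep (hU : U.IsMixing) (x y : OneParticle U) :
    Tendsto (fun t => inner ℂ x (oneParticleRep U t y)) (cocompact ℝ) (𝓝 0) := by
  have hC : ∀ z w : Complexification H,
      Tendsto (fun t => inner ℂ z (U.complexify t w)) (cocompact ℝ) (𝓝 0) := by
    intro z w
    have hre : ∀ a b c d : H, Tendsto (fun t => inner ℝ a (U t b) + inner ℝ c (U t d))
        (cocompact ℝ) (𝓝 0) := by
      intro a b c d
      have := (hU b a).add (hU d c)
      simpa only [real_inner_comm, add_zero] using this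
    have h1 := hre z.re w.re z.im w.im
    have h2 := hre z.re w.im (-z.im) w.re
    have := ((continuous_ofReal.tendsto _).comp h1).add
      (((continuous_ofReal.tendsto _).comp h2).mul_const I)
    rw [ofReal_zero, zero_mul, add_zero] at this
    refine this.congr fun t => ?_
    rw [inner_def]
    apply Complex.ext <;> simp [IsometricRep.complexify]
    all_goals rfl
  have key := tendsto_inner_of_dense_span (l := cocompact ℝ) (fun t => oneParticleRep U t) 0
    (dense_span_range_realInclusion U) (by
      rintro _ ⟨x, rfl⟩ _ ⟨y, rfl⟩
      have := hC (twoDivOneAddInv U.complexify (mk x 0)) (mk y 0)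
      simp only [zero_apply, inner_zero_right]
      refine this.congr fun t => ?_
      rw [oneParticleRep_realInclusion, inner_realInclusion]
      congr 1
      change mk (U t y) (U t 0) = _
      rw [map_zero]) x y
  simpa using key

end OneParticle

/-! ### Left and right creation operators on the Fock space -/

section Fock

variable {E : Type*} [NormedAddCommGroup E] [InnerProductSpace ℂ E]

theorem dense_span_range_tensor :
    Dense (Submodule.span ℂ (Set.range (tensor : List E → FockSpace E)) : Set (FockSpace E)) := by
  refine (UniformSpace.Completion.denseRange_coe (α := PreFock E)).mono ?_
  rintro _ ⟨f, rfl⟩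
  induction f using Finsupp.induction_linear with
  | zero =>
    rw [show ((0 : PreFock E) : FockSpace E) = 0 from UniformSpace.Completion.coe_zero]
    exact zero_mem _
  | add f g hf hg =>
    rw [UniformSpace.Completion.coe_add]
    exact add_mem hf hg
  | single v a =>
    have : ((Finsupp.single v a : PreFock E) : FockSpace E) = a • tensor v := by
      rw [tensor, ← UniformSpace.Completion.coe_smul, preTensor, Finsupp.smul_single, smul_eq_mul,
        mul_one]
    rw [this]
    exact Submodule.smul_mem _ _ (Submodule.subset_span ⟨v, rfl⟩)

theorem ext_inner_tensor {f g : FockSpace E}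
    (h : ∀ v : List E, inner ℂ (tensor v) f = inner ℂ (tensor v) g) : f = g := by
  refine dense_span_range_tensor.eq_of_inner_right ℂ fun u hu => ?_
  induction hu using Submodule.span_induction with
  | mem u hu =>
    obtain ⟨v, rfl⟩ := hu
    exact h v
  | zero => simp
  | add u v _ _ hu hv => rw [inner_add_left, inner_add_left, hu, hv]
  | smul c u _ hu => rw [inner_smul_left, inner_smul_left, hu]

theorem clm_ext_tensor {F : Type*} [NormedAddCommGroup F] [NormedSpace ℂ F]
    {S T : FockSpace E →L[ℂ] F} (h : ∀ v : List E, S (tensor v) = T (tensor v)) : S = T :=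
  ContinuousLinearMap.ext_on dense_span_range_tensor (by rintro _ ⟨v, rfl⟩; exact h v)

theorem star_creation_tensor_cons (x y : E) (v : List E) :
    star (creation x) (tensor (y :: v)) = inner ℂ x y • tensor v := by
  refine ext_inner_tensor fun w => ?_
  rw [ContinuousLinearMap.star_eq_adjoint, ContinuousLinearMap.adjoint_inner_right, creation_tensor,
    inner_tensor, inner_smul_right, inner_tensor, tensorInner]

theorem star_creation_tensor_nil (x : E) : star (creation x) (tensor []) = 0 := by
  refine ext_inner_tensor fun w => ?_
  rw [ContinuousLinearMap.star_eq_adjoint, ContinuousLinearMap.adjoint_inner_right, creation_tensor,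
    inner_tensor, tensorInner, inner_zero_right]

theorem star_creation_mul_creation (x y : E) :
    star (creation x) * creation y = inner ℂ x y • (1 : FockSpace E →L[ℂ] FockSpace E) :=
  clm_ext_tensor fun v => by simp [star_creation_tensor_cons, creation_tensor]

theorem star_creation_creation (x y : E) (f : FockSpace E) :
    star (creation x) (creation y f) = inner ℂ x y • f :=
  DFunLike.congr_fun (star_creation_mul_creation x y) f

theorem creation_sub (x y : E) : creation (x - y) = creation x - creation y := by
  refine clm_ext_tensor fun v => ext_inner_tensor fun w => ?_
  rw [sub_apply, inner_sub_right]
  simp only [creation_tensor, inner_tensor]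
  cases w with
  | nil => simp [tensorInner]
  | cons a w => simp [tensorInner, sub_mul]

/-- Immediate from `ℓ(x)^* ℓ(x) = ‖x‖²`. Applied to differences, it makes `ℓ(x) f` continuous in the
letter `x`. -/
theorem norm_creation_apply (x : E) (f : FockSpace E) : ‖creation x f‖ = ‖x‖ * ‖f‖ := by
  rw [← sq_eq_sq₀ (norm_nonneg _) (by positivity), mul_pow, @norm_sq_eq_re_inner ℂ,
    ← ContinuousLinearMap.adjoint_inner_right, ← ContinuousLinearMap.star_eq_adjoint,
    star_creation_creation, inner_smul_right, inner_self_eq_norm_sq_to_K, inner_self_eq_norm_sq_to_K]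
  norm_cast

theorem continuous_creation_apply (f : FockSpace E) : Continuous fun x : E => creation x f := by
  refine continuous_iff_continuousAt.2 fun x => tendsto_iff_norm_sub_tendsto_zero.2 ?_
  have h : Tendsto (fun y => ‖y - x‖ * ‖f‖) (𝓝 x) (𝓝 (0 * ‖f‖)) :=
    (tendsto_iff_norm_sub_tendsto_zero.1 tendsto_id).mul_const _
  rw [zero_mul] at h
  refine h.congr fun y => ?_
  rw [← norm_creation_apply, creation_sub, sub_apply]

theorem tensorInner_append_singleton (v w : List E) (x y : E) :
    tensorInner (v ++ [x]) (w ++ [y]) = inner ℂ x y * tensorInner v w := by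
  induction v generalizing w with
  | nil => rcases w with _ | ⟨b, _ | ⟨c, w⟩⟩ <;> simp [tensorInner]
  | cons a v ih =>
    cases w with
    | nil => rcases v with _ | ⟨b, v⟩ <;> simp [tensorInner]
    | cons b w =>
      simp only [List.cons_append, tensorInner, ih]
      ring

/-- The right creation operator `v₁ ⊗ ⋯ ⊗ vₙ ↦ v₁ ⊗ ⋯ ⊗ vₙ ⊗ x`. -/
noncomputable def rightCreation (x : E) : FockSpace E →L[ℂ] FockSpace E :=
  ((preFockMap (· ++ [x])).mkContinuous ‖x‖ fun f => by
    refine abs_le_of_sq_le_sq' ?_ (by positivity) |>.2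
    refine le_of_eq ?_
    rw [mul_pow, norm_sq_eq_re_inner (𝕜 := ℂ), preFockMap_inner (c := inner ℂ x x)
      (fun v w => tensorInner_append_singleton v w x x), inner_self_eq_norm_sq_to_K,
      inner_self_eq_norm_sq_to_K]
    norm_cast).completion

theorem rightCreation_tensor (x : E) (v : List E) :
    rightCreation x (tensor v) = tensor (v ++ [x]) := by
  rw [rightCreation, tensor, ContinuousLinearMap.completion_apply_coe, tensor]
  congr 1
  exact Finsupp.mapDomain_single

theorem star_rightCreation_tensor_append (x y : E) (v : List E) :
    star (rightCreation x) (tensor (v ++ [y])) = inner ℂ x y • tensor v := by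
  refine ext_inner_tensor fun w => ?_
  rw [ContinuousLinearMap.star_eq_adjoint, ContinuousLinearMap.adjoint_inner_right,
    rightCreation_tensor, inner_tensor, inner_smul_right, inner_tensor,
    tensorInner_append_singleton]

theorem star_rightCreation_tensor_nil (x : E) : star (rightCreation x) (tensor []) = 0 := by
  refine ext_inner_tensor fun w => ?_
  rw [ContinuousLinearMap.star_eq_adjoint, ContinuousLinearMap.adjoint_inner_right,
    rightCreation_tensor, inner_tensor, inner_zero_right]
  cases w <;> simp [tensorInner]

theorem star_rightCreation_tensor_singleton (x y : E) :
    star (rightCreation x) (tensor [y]) = inner ℂ x y • tensor [] := by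
  rw [← List.nil_append [y], star_rightCreation_tensor_append]

/-- Isolates the algebra of `(ℓ + ℓ^*)(r + r^*)`: the pure terms commute separately, while the mixed
ones commute only in sum. -/
theorem add_mul_add_comm_of_mul_comm {R : Type*} [Ring R] {p q r s : R} (h1 : p * r = r * p)
    (h2 : q * s = s * q) (h3 : p * s + q * r = s * p + r * q) :
    (p + q) * (r + s) = (r + s) * (p + q) := by
  calc _ = p * r + (p * s + q * r) + q * s := by noncomm_ring
    _ = _ := by
      rw [h1, h2, h3]
      noncomm_ring

theorem creation_mul_rightCreation (x y : E) :
    creation x * rightCreation y = rightCreation y * creation x :=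
  clm_ext_tensor fun v => by simp [creation_tensor, rightCreation_tensor]

/-- `r(a) + r(b)^*` commutes with `ℓ(x) + ℓ(x)^*` if `⟨x, a⟩ = ⟨b, x⟩`. -/
theorem commute_rightCreation_add_star {x a b : E} (h : inner ℂ x a = inner ℂ b x) :
    (creation x + star (creation x)) * (rightCreation a + star (rightCreation b)) =
      (rightCreation a + star (rightCreation b)) * (creation x + star (creation x)) := by
  have h1 := creation_mul_rightCreation x a
  have h2 : star (creation x) * star (rightCreation b) =
      star (rightCreation b) * star (creation x) := by
    rw [← star_mul, ← star_mul, creation_mul_rightCreation]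
  -- On nonempty tensors the mixed terms act at opposite ends and commute. Only on the vacuum do
  -- they meet, where they give `⟨x, a⟩ Ω` and `⟨b, x⟩ Ω`.
  have h3 : creation x * star (rightCreation b) + star (creation x) * rightCreation a =
      star (rightCreation b) * creation x + rightCreation a * star (creation x) := by
    refine clm_ext_tensor fun v => ?_
    simp only [add_apply, mul_apply_eq_comp]
    rcases v with _ | ⟨c, v⟩
    · rw [rightCreation_tensor, List.nil_append, creation_tensor, star_rightCreation_tensor_nil,
        star_creation_tensor_nil, map_zero, map_zero, star_creation_tensor_cons,
        star_rightCreation_tensor_singleton, h, zero_add, add_zero]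
    · have e1 : star (creation x) (rightCreation a (tensor (c :: v))) =
          rightCreation a (star (creation x) (tensor (c :: v))) := by
        rw [rightCreation_tensor, List.cons_append, star_creation_tensor_cons,
          star_creation_tensor_cons, map_smul, rightCreation_tensor]
      have e2 : creation x (star (rightCreation b) (tensor (c :: v))) =
          star (rightCreation b) (creation x (tensor (c :: v))) := by
        obtain ⟨l, d, hl⟩ : ∃ l d, c :: v = l ++ [d] :=
          ⟨_, _, (List.dropLast_append_getLast (List.cons_ne_nil c v)).symm⟩
        rw [hl, creation_tensor, star_rightCreation_tensor_append, ← List.cons_append,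
          star_rightCreation_tensor_append, map_smul, creation_tensor]
      rw [e1, e2]
  exact add_mul_add_comm_of_mul_comm h1 h2 h3

theorem semicircular_vacuum (x : E) : semicircular x (vacuum E) = (2⁻¹ : ℂ) • tensor [x] := by
  simp only [semicircular, smul_apply, add_apply, vacuum, star_creation_tensor_nil, add_zero]
  rw [creation_tensor]

theorem star_semicircular (x : E) : star (semicircular x) = semicircular x := by
  simp [semicircular, star_smul, add_comm]

end Fock

/-! ### The vacuum vector is separating -/

section Separating

variable {E : Type*} [NormedAddCommGroup E] [InnerProductSpace ℂ E]

/-- The closed span of the tensors with letters in `D` is stable under `ℓ(a)` for `a ∈ D`, hence for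
all `a` by continuity in the letter; starting from `Ω` it exhausts the Fock space. -/
theorem eq_zero_of_tensor_mem {D : Set E} (hD : Dense D) {T : FockSpace E →L[ℂ] FockSpace E}
    (hT : ∀ v : List E, (∀ a ∈ v, a ∈ D) → T (tensor v) = 0) : T = 0 := by
  set S : Submodule ℂ (FockSpace E) :=
    (Submodule.span ℂ {f | ∃ v : List E, (∀ a ∈ v, a ∈ D) ∧ tensor v = f}).topologicalClosure
  have hSc : IsClosed (S : Set (FockSpace E)) := Submodule.isClosed_topologicalClosure _
  have hcD : ∀ a ∈ D, ∀ f ∈ S, creation a f ∈ S := by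
    intro a ha f hf
    refine map_mem_closure (creation a).continuous hf fun g hg => ?_
    induction hg using Submodule.span_induction with
    | mem g hg =>
      obtain ⟨v, hv, rfl⟩ := hg
      rw [creation_tensor]
      refine Submodule.subset_span ⟨a :: v, ?_, rfl⟩
      simpa [ha] using hv
    | zero => rw [map_zero]; exact zero_mem _
    | add g g' _ _ h h' => rw [map_add]; exact add_mem h h'
    | smul c g _ h => rw [map_smul]; exact Submodule.smul_mem _ _ h
  have hc : ∀ a : E, ∀ f ∈ S, creation a f ∈ S := by
    intro a f hf
    have : a ∈ closure D := hD a
    exact hSc.closure_subset (map_mem_closure (f := fun b : E => creation b f)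
      (continuous_creation_apply f) this fun b hb => hcD b hb f hf)
  have hmem : ∀ v : List E, tensor v ∈ S := by
    intro v
    induction v with
    | nil => exact Submodule.le_topologicalClosure _ (Submodule.subset_span ⟨[], by simp, rfl⟩)
    | cons a v ih =>
      rw [← creation_tensor]
      exact hc a _ ih
  have hker : S ≤ (T : FockSpace E →ₗ[ℂ] FockSpace E).ker := by
    refine Submodule.topologicalClosure_minimal _ (Submodule.span_le.2 ?_) T.isClosed_ker
    rintro _ ⟨v, hv, rfl⟩
    exact hT v hv
  refine clm_ext_tensor fun v => ?_
  exact hker (hmem v)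

/-- The vacuum vector is separating for every operator commuting with sufficiently many operators
`r(a) + r(b)^*`. -/
theorem eq_zero_of_apply_vacuum_eq_zero {P : E → E → Prop} (hP : Dense {a | ∃ b, P a b})
    {T : FockSpace E →L[ℂ] FockSpace E}
    (hT : ∀ a b, P a b → (rightCreation a + star (rightCreation b)) * T =
      T * (rightCreation a + star (rightCreation b))) (h0 : T (vacuum E) = 0) : T = 0 := by
  refine eq_zero_of_tensor_mem hP ?_
  have key : ∀ n, ∀ v : List E, v.length = n → (∀ a ∈ v, a ∈ {a | ∃ b, P a b}) →
      T (tensor v) = 0 := by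
    intro n
    induction n using Nat.strong_induction_on with
    | _ n ih =>
      intro v hn hv
      rcases v.eq_nil_or_concat' with rfl | ⟨l, a, rfl⟩
      · exact h0
      obtain ⟨b, hb⟩ := hv a (by simp)
      have hl : ∀ c ∈ l, c ∈ {a | ∃ b, P a b} := fun c hc => hv c (by simp [hc])
      -- Applying the commutation to `l` expresses `T (l ⊗ a)` through `T l` and `T (r(b)^* l)`. The
      -- latter tensor is two letters shorter than `l ⊗ a`, hence the strong induction.
      have h1 := DFunLike.congr_fun (hT a b hb) (tensor l)
      simp only [mul_apply_eq_comp, add_apply, map_add] at h1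
      rw [ih l.length (by simp at hn; omega) l rfl hl, map_zero, map_zero, add_zero,
        rightCreation_tensor] at h1
      have h2 : T (star (rightCreation b) (tensor l)) = 0 := by
        rcases l.eq_nil_or_concat' with rfl | ⟨l', c, rfl⟩
        · rw [star_rightCreation_tensor_nil, map_zero]
        · rw [star_rightCreation_tensor_append, map_smul, ih l'.length (by simp at hn; omega) l' rfl
            (fun d hd => hl d (by simp [hd])), smul_zero]
      rw [h2, add_zero] at h1
      exact h1.symm
  exact fun v hv => key _ v rfl hv

end Separating

/-! ### Wick words -/

section Wick

variable {E : Type*} [NormedAddCommGroup E] [InnerProductSpace ℂ E]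

/-- `ℓ(v₁) ⋯ ℓ(vₙ)`. -/
noncomputable def creationWord : List E → FockSpace E →L[ℂ] FockSpace E
  | [] => 1
  | x :: v => creation x * creationWord v

/-- `ℓ(v₁)^* ⋯ ℓ(vₙ)^*`. -/
noncomputable def annihilationWord : List E → FockSpace E →L[ℂ] FockSpace E
  | [] => 1
  | x :: v => star (creation x) * annihilationWord v

/-- The Wick word `∑ₖ ℓ(v₁) ⋯ ℓ(vₖ) ℓ(vₖ₊₁)^* ⋯ ℓ(vₙ)^*`. -/
noncomputable def wickWord : List E → FockSpace E →L[ℂ] FockSpace E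
  | [] => 1
  | x :: v => creation x * wickWord v + annihilationWord (x :: v)

theorem creationWord_append_singleton (v : List E) (x : E) :
    creationWord (v ++ [x]) = creationWord v * creation x := by
  induction v with
  | nil => simp [creationWord]
  | cons a v ih => simp [creationWord, ih, mul_assoc]

theorem annihilationWord_append_singleton (v : List E) (x : E) :
    annihilationWord (v ++ [x]) = annihilationWord v * star (creation x) := by
  induction v with
  | nil => simp [annihilationWord]
  | cons a v ih => simp [annihilationWord, ih, mul_assoc]

/-- Mirror image of the defining recursion, peeling off the last letter; taking adjoints exchanges
the two recursions. -/
theorem wickWord_append_singleton (v : List E) (x : E) :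
    wickWord (v ++ [x]) = wickWord v * star (creation x) + creationWord (v ++ [x]) := by
  induction v with
  | nil => simp [wickWord, creationWord, annihilationWord, add_comm]
  | cons a v ih =>
    simp only [List.cons_append, wickWord, ih, creationWord, annihilationWord,
      annihilationWord_append_singleton, mul_add, add_mul, mul_assoc]
    abel

theorem star_annihilationWord (v : List E) :
    star (annihilationWord v) = creationWord v.reverse := by
  induction v with
  | nil => simp [annihilationWord, creationWord]
  | cons a v ih => simp [annihilationWord, creationWord_append_singleton, ih]

theorem star_wickWord (v : List E) : star (wickWord v) = wickWord v.reverse := by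
  induction v with
  | nil => simp [wickWord]
  | cons a v ih =>
    rw [wickWord, star_add, star_mul, ih, star_annihilationWord, List.reverse_cons,
      wickWord_append_singleton]

theorem annihilationWord_cons_vacuum (x : E) (v : List E) :
    annihilationWord (x :: v) (vacuum E) = 0 := by
  induction v generalizing x with
  | nil => simp [annihilationWord, vacuum, star_creation_tensor_nil]
  | cons a v ih => rw [annihilationWord, mul_apply_eq_comp, ih, map_zero]

/-- Every summand ending in an annihilation operator kills `Ω`, leaving only the product of creation
operators. -/
theorem wickWord_vacuum (v : List E) : wickWord v (vacuum E) = tensor v := by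
  induction v with
  | nil => rfl
  | cons a v ih =>
    rw [wickWord, add_apply, annihilationWord_cons_vacuum, add_zero, mul_apply_eq_comp,
      ih, creation_tensor]

/-- The relation `ℓ(x)^* ℓ(y) = ⟨x, y⟩` contracts the first letter. Consequently the span of Wick
words with letters in `H_ℝ` is stable under left multiplication by the generators. -/
theorem semicircular_mul_wickWord (x : E) (v : List E) : semicircular x * wickWord v =
    (2⁻¹ : ℂ) • (wickWord (x :: v) + match v with
      | [] => 0
      | y :: w => inner ℂ x y • wickWord w) := by
  rw [semicircular, smul_mul_assoc, add_mul]
  congr 1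
  cases v with
  | nil => simp [wickWord, annihilationWord]
  | cons y w =>
    simp only [wickWord, annihilationWord, mul_add, ← mul_assoc, star_creation_mul_creation,
      smul_mul_assoc, one_mul]
    abel

end Wick

/-! ### Bicommutant density at one vector and its adjoint -/

section Density

variable {K : Type*} [NormedAddCommGroup K] [InnerProductSpace ℂ K]

/-- Stability of `N` under the adjoint `G'` makes `Nᗮ` stable under `G`, so `G` respects the
decomposition. -/
theorem starProjection_apply_comm [CompleteSpace K] {N : Submodule ℂ K}
    [N.HasOrthogonalProjection] {G G' : K →L[ℂ] K}
    (hadj : ∀ f h, inner ℂ (G f) h = inner ℂ f (G' h)) (hG : ∀ f ∈ N, G f ∈ N)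
    (hG' : ∀ f ∈ N, G' f ∈ N) (f : K) : N.starProjection (G f) = G (N.starProjection f) := by
  refine Submodule.eq_starProjection_of_mem_of_inner_eq_zero
    (hG _ (N.starProjection_apply_mem f)) fun w hw => ?_
  rw [← map_sub, hadj]
  exact N.starProjection_inner_eq_zero f _ (hG' w hw)

/-- The operator `g ⊕ g` on `K ⊕ K`. -/
noncomputable def ampliation (g : K →L[ℂ] K) : WithLp 2 (K × K) →L[ℂ] WithLp 2 (K × K) :=
  (WithLp.prodContinuousLinearEquiv 2 ℂ K K).symm.toContinuousLinearMap ∘L (g.prodMap g) ∘L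
    (WithLp.prodContinuousLinearEquiv 2 ℂ K K).toContinuousLinearMap

theorem inner_ampliation_left [CompleteSpace K] (g : K →L[ℂ] K) (f h : WithLp 2 (K × K)) :
    inner ℂ (ampliation g f) h = inner ℂ f (ampliation (star g) h) := by
  rw [WithLp.prod_inner_apply, WithLp.prod_inner_apply, ContinuousLinearMap.star_eq_adjoint]
  change inner ℂ (g f.fst) h.fst + inner ℂ (g f.snd) h.snd =
    inner ℂ f.fst (ContinuousLinearMap.adjoint g h.fst) +
      inner ℂ f.snd (ContinuousLinearMap.adjoint g h.snd)
  rw [ContinuousLinearMap.adjoint_inner_right, ContinuousLinearMap.adjoint_inner_right]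

theorem mul_comm_of_mem_generated [CompleteSpace K] {S : Set (K →L[ℂ] K)}
    (hS : ∀ g ∈ S, star g ∈ S) {x c : K →L[ℂ] K}
    (hx : x ∈ (generatedVonNeumannAlgebra S).toStarSubalgebra) (hc : ∀ g ∈ S, g * c = c * g) :
    c * x = x * c := by
  change x ∈ StarSubalgebra.centralizer ℂ _ at hx
  rw [StarSubalgebra.mem_centralizer_iff] at hx
  refine (hx c ?_).1
  rw [SetLike.mem_coe, StarSubalgebra.mem_centralizer_iff]
  exact fun g hg => ⟨hc g hg, hc _ (hS g hg)⟩

/-- Von Neumann's density theorem, for two vectors. -/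
theorem mem_closure_of_mem_generated [CompleteSpace K] {S : Set (K →L[ℂ] K)}
    (hS : ∀ g ∈ S, star g ∈ S) {A : Submodule ℂ (K →L[ℂ] K)} (h1 : 1 ∈ A)
    (hA : ∀ g ∈ S, ∀ a ∈ A, g * a ∈ A) {x : K →L[ℂ] K}
    (hx : x ∈ (generatedVonNeumannAlgebra S).toStarSubalgebra) (u v : K) :
    WithLp.toLp 2 (x u, x v) ∈
      closure ((fun a : K →L[ℂ] K => WithLp.toLp 2 (a u, a v)) '' (A : Set (K →L[ℂ] K))) := by
  let ev : (K →L[ℂ] K) →ₗ[ℂ] WithLp 2 (K × K) :=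
    { toFun := fun a => WithLp.toLp 2 (a u, a v)
      map_add' := fun a b => rfl
      map_smul' := fun c a => rfl }
  set N : Submodule ℂ (WithLp 2 (K × K)) := (A.map ev).topologicalClosure with hN
  have : CompleteSpace N := (Submodule.isClosed_topologicalClosure _).completeSpace_coe
  set P := N.starProjection
  have hinv : ∀ g ∈ S, ∀ f ∈ N, ampliation g f ∈ N := by
    intro g hg f hf
    refine map_mem_closure (ampliation g).continuous hf ?_
    rintro _ ⟨a, ha, rfl⟩
    exact ⟨g * a, hA g hg a ha, rfl⟩
  have hcomm : ∀ g ∈ S, ∀ f, P (ampliation g f) = ampliation g (P f) := fun g hg f =>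
    starProjection_apply_comm (inner_ampliation_left g) (hinv g hg) (hinv _ (hS g hg)) f
  let e := WithLp.prodContinuousLinearEquiv 2 ℂ K K
  let i₁ : K →L[ℂ] WithLp 2 (K × K) := e.symm.toContinuousLinearMap ∘L .inl ℂ K K
  let i₂ : K →L[ℂ] WithLp 2 (K × K) := e.symm.toContinuousLinearMap ∘L .inr ℂ K K
  let p₁ : WithLp 2 (K × K) →L[ℂ] K := .fst ℂ K K ∘L e.toContinuousLinearMap
  let p₂ : WithLp 2 (K × K) →L[ℂ] K := .snd ℂ K K ∘L e.toContinuousLinearMap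
  have hi₁ : ∀ (g : K →L[ℂ] K) w, i₁ (g w) = ampliation g (i₁ w) := fun g w => by
    change WithLp.toLp 2 (g w, (0 : K)) = WithLp.toLp 2 (g w, g 0)
    rw [map_zero]
  have hi₂ : ∀ (g : K →L[ℂ] K) w, i₂ (g w) = ampliation g (i₂ w) := fun g w => by
    change WithLp.toLp 2 ((0 : K), g w) = WithLp.toLp 2 (g 0, g w)
    rw [map_zero]
  have hsum : ∀ f : WithLp 2 (K × K), f = i₁ (p₁ f) + i₂ (p₂ f) := fun f => by
    refine WithLp.ofLp_injective 2 (Prod.ext ?_ ?_)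
    · exact (add_zero _).symm
    · exact (zero_add _).symm
  -- Each matrix entry `p P i` of `P` commutes with `S`, hence with `x`; assembling the entries
  -- shows that `P` commutes with `x ⊕ x`.
  have hcx : ∀ (i : K →L[ℂ] WithLp 2 (K × K)) (p : WithLp 2 (K × K) →L[ℂ] K),
      (∀ (g : K →L[ℂ] K) w, i (g w) = ampliation g (i w)) →
      (∀ (g : K →L[ℂ] K) f, p (ampliation g f) = g (p f)) →
      ∀ w, p (P (i (x w))) = x (p (P (i w))) := by
    intro i p hi hp w
    have := mul_comm_of_mem_generated hS hx (c := p ∘L P ∘L i) fun g hg => by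
      ext w
      change g (p (P (i w))) = p (P (i (g w)))
      rw [hi, hcomm g hg, hp]
    exact DFunLike.congr_fun this w
  have hcommx : ∀ f, P (ampliation x f) = ampliation x (P f) := by
    intro f
    have key : ∀ (i : K →L[ℂ] WithLp 2 (K × K)),
        (∀ (g : K →L[ℂ] K) w, i (g w) = ampliation g (i w)) →
        ∀ w, P (i (x w)) = ampliation x (P (i w)) := by
      intro i hi w
      rw [hsum (P (i (x w))), hcx i p₁ hi (fun _ _ => rfl), hcx i p₂ hi (fun _ _ => rfl), hi₁, hi₂,
        ← map_add, ← hsum]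
    rw [hsum f, map_add, ← hi₁, ← hi₂, map_add, key i₁ hi₁, key i₂ hi₂, ← map_add, ← map_add]
  have hmem : WithLp.toLp 2 (u, v) ∈ N :=
    Submodule.le_topologicalClosure _ ⟨1, h1, rfl⟩
  have : ampliation x (WithLp.toLp 2 (u, v)) ∈ N := by
    rw [← Submodule.starProjection_eq_self_iff.2 hmem]
    change ampliation x (P (WithLp.toLp 2 (u, v))) ∈ N
    rw [← hcommx]
    exact N.starProjection_apply_mem _
  exact this

/-- A `*`-invariant version of the density theorem: one can approximate `x u` and `x^* u`
simultaneously. -/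
theorem exists_seq_tendsto_of_mem_generated [CompleteSpace K] {S : Set (K →L[ℂ] K)}
    (hS : ∀ g ∈ S, star g ∈ S) {A : Submodule ℂ (K →L[ℂ] K)} (h1 : 1 ∈ A)
    (hA : ∀ g ∈ S, ∀ a ∈ A, g * a ∈ A) {x : K →L[ℂ] K}
    (hx : x ∈ (generatedVonNeumannAlgebra S).toStarSubalgebra) (u : K) :
    ∃ a : ℕ → K →L[ℂ] K, (∀ n, a n ∈ A) ∧ Tendsto (fun n => a n u) atTop (𝓝 (x u)) ∧
      Tendsto (fun n => star (a n) u) atTop (𝓝 (star x u)) := by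
  -- The pairs `(a u, a^* u)` form only a real subspace, since `a ↦ a^*` is conjugate linear; its
  -- closure is computed as a real double orthogonal complement.
  let : InnerProductSpace ℝ (WithLp 2 (K × K)) := InnerProductSpace.rclikeToReal ℂ _
  let R : Submodule ℝ (WithLp 2 (K × K)) :=
    { carrier := (fun a : K →L[ℂ] K => WithLp.toLp 2 (a u, star a u)) '' (A : Set (K →L[ℂ] K))
      zero_mem' := ⟨0, zero_mem _, by simp⟩
      add_mem' := by
        rintro _ _ ⟨a, ha, rfl⟩ ⟨b, hb, rfl⟩
        refine ⟨a + b, add_mem ha hb, ?_⟩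
        simp only [star_add]
        rfl
      smul_mem' := by
        rintro c _ ⟨a, ha, rfl⟩
        refine ⟨(c : ℂ) • a, A.smul_mem _ ha, ?_⟩
        simp only [star_smul, RCLike.star_def, conj_ofReal]
        rfl }
  have hmem : WithLp.toLp 2 (x u, star x u) ∈ R.topologicalClosure := by
    rw [← Submodule.orthogonal_orthogonal_eq_closure, Submodule.mem_orthogonal]
    intro w hw
    rw [Submodule.mem_orthogonal] at hw
    have hre : ∀ a : K →L[ℂ] K, inner ℝ (WithLp.toLp 2 (a u, star a u)) w =
        (inner ℂ w.fst (a u) + inner ℂ u (a w.snd)).re := by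
      intro a
      change (inner ℂ (WithLp.toLp 2 (a u, star a u)) w).re = _
      rw [WithLp.prod_inner_apply]
      change (inner ℂ (a u) w.fst + inner ℂ (star a u) w.snd).re = _
      rw [ContinuousLinearMap.star_eq_adjoint, ContinuousLinearMap.adjoint_inner_left, add_re,
        add_re, ← inner_conj_symm, conj_re]
    -- Testing with both `a` and `i a` recovers the imaginary part. The resulting condition no
    -- longer involves `a^*`, so density at the two vectors `u` and `w.snd` transfers it to `x`.
    have hzero : ∀ a ∈ A, inner ℂ w.fst (a u) + inner ℂ u (a w.snd) = 0 := by
      intro a ha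
      have e1 := hw _ ⟨a, ha, rfl⟩
      have e2 := hw _ ⟨I • a, A.smul_mem _ ha, rfl⟩
      rw [hre] at e1 e2
      simp only [smul_apply, inner_smul_right, ← mul_add] at e2
      apply Complex.ext
      · exact e1
      · rw [zero_im, ← neg_eq_zero]
        simpa using e2
    rw [real_inner_comm, hre]
    have hcl := mem_closure_of_mem_generated hS h1 hA hx u w.snd
    have hcont : Continuous fun f : WithLp 2 (K × K) => inner ℂ w.fst f.fst + inner ℂ u f.snd :=
      (continuous_const.inner (WithLp.fstL 2 ℂ K K).continuous).add
        (continuous_const.inner (WithLp.sndL 2 ℂ K K).continuous)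
    have : WithLp.toLp 2 (x u, x w.snd) ∈
        {f : WithLp 2 (K × K) | inner ℂ w.fst f.fst + inner ℂ u f.snd = 0} := by
      refine closure_minimal ?_ (isClosed_eq hcont continuous_const) hcl
      rintro _ ⟨a, ha, rfl⟩
      exact hzero a ha
    have h0 : inner ℂ w.fst (x u) + inner ℂ u (x w.snd) = 0 := this
    rw [h0, zero_re]
  obtain ⟨f, hf, hlim⟩ := mem_closure_iff_seq_limit.1 hmem
  choose a ha haf using hf
  refine ⟨a, ha, ?_, ?_⟩
  · have := ((WithLp.fstL 2 ℂ K K).continuous.tendsto _).comp hlim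
    exact this.congr fun n => by rw [Function.comp_apply, ← haf]; rfl
  · have := ((WithLp.sndL 2 ℂ K K).continuous.tendsto _).comp hlim
    exact this.congr fun n => by rw [Function.comp_apply, ← haf]; rfl

end Density

/-! ### The KMS condition for pairs of operators -/

section Rep

variable {K : Type*} [NormedAddCommGroup K] [InnerProductSpace ℂ K] (V : IsometricRep ℂ K)

theorem IsometricRep.continuous_apply {X : Type*} [TopologicalSpace X] {τ : X → ℝ} {f : X → K}
    (hτ : Continuous τ) (hf : Continuous f) : Continuous fun s => V (τ s) (f s) := by
  refine continuous_iff_continuousAt.2 fun s => tendsto_iff_dist_tendsto_zero.2 ?_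
  have h1 : Tendsto (fun r => dist (f r) (f s) + dist (V (τ r) (f s)) (V (τ s) (f s))) (𝓝 s)
      (𝓝 (0 + 0)) :=
    (tendsto_iff_dist_tendsto_zero.1 (hf.tendsto s)).add
      (tendsto_iff_dist_tendsto_zero.1 (((V.continuous' (f s)).comp hτ).tendsto s))
  rw [add_zero] at h1
  refine squeeze_zero (fun _ => dist_nonneg) (fun r => ?_) h1
  refine (dist_triangle _ (V (τ r) (f s)) _).trans ?_
  rw [(V (τ r)).dist_map]

/-- Isometry of `V_t` makes the Cauchy–Schwarz error independent of `t`; uniformity on the boundary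
lines is what the limit of strip functions requires. -/
theorem IsometricRep.tendstoUniformly_inner {p q : ℕ → K} {p₀ q₀ : K}
    (hp : Tendsto p atTop (𝓝 p₀)) (hq : Tendsto q atTop (𝓝 q₀)) :
    TendstoUniformly (fun n t => inner ℂ (p n) (V t (q n))) (fun t => inner ℂ p₀ (V t q₀))
      atTop := by
  have h0 : Tendsto (fun n => ‖p n - p₀‖ * ‖q n‖ + ‖p₀‖ * ‖q n - q₀‖) atTop
      (𝓝 (0 * ‖q₀‖ + ‖p₀‖ * 0)) :=
    ((tendsto_iff_norm_sub_tendsto_zero.1 hp).mul hq.norm).add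
      ((tendsto_iff_norm_sub_tendsto_zero.1 hq).const_mul _)
  rw [zero_mul, mul_zero, add_zero] at h0
  refine Metric.tendstoUniformly_iff.2 fun ε hε => ?_
  filter_upwards [h0.eventually_lt_const hε] with n hn t
  refine lt_of_le_of_lt ?_ hn
  rw [dist_comm, dist_eq_norm]
  have : inner ℂ (p n) (V t (q n)) - inner ℂ p₀ (V t q₀) =
      inner ℂ (p n - p₀) (V t (q n)) + inner ℂ p₀ (V t (q n - q₀)) := by
    rw [map_sub, inner_sub_left, inner_sub_right]
    ring
  rw [this]
  refine (norm_add_le _ _).trans (add_le_add ?_ ?_)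
  · exact (norm_inner_le_norm _ _).trans_eq (by rw [(V t).norm_map])
  · exact (norm_inner_le_norm _ _).trans_eq (by rw [(V t).norm_map])

/-- The KMS condition for the operators `a`, `b`, the state `⟨· w, w⟩` and the group
`Ad(V_{-t})`. -/
def SatisfiesKMS [CompleteSpace K] (w : K) (a b : K →L[ℂ] K) : Prop :=
  ∃ F : ℂ → ℂ, IsStripAnalytic 0 1 F ∧ ∀ t : ℝ, F t = inner ℂ (star a w) (V t (b w)) ∧
    F (t + I) = inner ℂ (V t (star b w)) (a w)

namespace SatisfiesKMS

variable [CompleteSpace K] {V} {w : K} {a b c : K →L[ℂ] K}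

theorem zero_left : SatisfiesKMS V w 0 b := ⟨0, .zero _ _, by simp⟩

theorem zero_right : SatisfiesKMS V w a 0 := ⟨0, .zero _ _, by simp⟩

theorem add_left (ha : SatisfiesKMS V w a c) (hb : SatisfiesKMS V w b c) :
    SatisfiesKMS V w (a + b) c := by
  obtain ⟨F, hF, hF'⟩ := ha
  obtain ⟨G, hG, hG'⟩ := hb
  refine ⟨F + G, hF.add hG, fun t => ?_⟩
  constructor
  · simp [(hF' t).1, (hG' t).1]
  · simp [(hF' t).2, (hG' t).2]

theorem add_right (ha : SatisfiesKMS V w a b) (hb : SatisfiesKMS V w a c) :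
    SatisfiesKMS V w a (b + c) := by
  obtain ⟨F, hF, hF'⟩ := ha
  obtain ⟨G, hG, hG'⟩ := hb
  refine ⟨F + G, hF.add hG, fun t => ?_⟩
  constructor
  · simp [(hF' t).1, (hG' t).1]
  · simp [(hF' t).2, (hG' t).2]

theorem smul_left (r : ℂ) (ha : SatisfiesKMS V w a b) : SatisfiesKMS V w (r • a) b := by
  obtain ⟨F, hF, hF'⟩ := ha
  refine ⟨fun z => r * F z, (IsStripAnalytic.const _ _ r).mul hF, fun t => ?_⟩
  constructor
  · simp [(hF' t).1, mul_comm]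
  · simp [(hF' t).2]

theorem smul_right (r : ℂ) (ha : SatisfiesKMS V w a b) : SatisfiesKMS V w a (r • b) := by
  obtain ⟨F, hF, hF'⟩ := ha
  refine ⟨fun z => r * F z, (IsStripAnalytic.const _ _ r).mul hF, fun t => ?_⟩
  constructor
  · simp [(hF' t).1]
  · simp [(hF' t).2, mul_comm]

theorem of_mem_span {S : Set (K →L[ℂ] K)} (h : ∀ a ∈ S, ∀ b ∈ S, SatisfiesKMS V w a b)
    (ha : a ∈ Submodule.span ℂ S) (hb : b ∈ Submodule.span ℂ S) : SatisfiesKMS V w a b := by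
  induction ha using Submodule.span_induction with
  | mem a ha =>
    induction hb using Submodule.span_induction with
    | mem b hb => exact h a ha b hb
    | zero => exact zero_right
    | add b c _ _ hb hc => exact hb.add_right hc
    | smul r b _ hb => exact hb.smul_right r
  | zero => exact zero_left
  | add b c _ _ hb hc => exact hb.add_left hc
  | smul r b _ hb => exact hb.smul_left r

/-- The boundary values involve `a^* w`, `b w` below and `b^* w`, `a w` above, so convergence on `w`
of the operators and of their adjoints suffices, without any operator topology. -/
theorem of_tendsto {p q : ℕ → K →L[ℂ] K} (h : ∀ n, SatisfiesKMS V w (p n) (q n))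
    (h1 : Tendsto (fun n => p n w) atTop (𝓝 (a w)))
    (h2 : Tendsto (fun n => star (p n) w) atTop (𝓝 (star a w)))
    (h3 : Tendsto (fun n => q n w) atTop (𝓝 (b w)))
    (h4 : Tendsto (fun n => star (q n) w) atTop (𝓝 (star b w))) : SatisfiesKMS V w a b := by
  choose F hF hF' using h
  obtain ⟨G, hG, hG'⟩ := exists_isStripAnalytic_of_tendstoUniformly zero_lt_one hF
    (f := fun t => inner ℂ (star a w) (V t (b w))) (g := fun t => inner ℂ (V t (star b w)) (a w))
    (by simpa [hF'] using V.tendstoUniformly_inner h2 h3)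
    (by
      have hc := isometry_conj.uniformContinuous.comp_tendstoUniformly (V.tendstoUniformly_inner h1 h4)
      simpa [hF', Function.comp_def] using hc)
  exact ⟨G, hG, fun t => by simpa using hG' t⟩

end SatisfiesKMS

end Rep

/-! ### Reversal of tensors and weak limits of the second quantization -/

section Tensor

variable {E : Type*} [NormedAddCommGroup E] [InnerProductSpace ℂ E]

theorem tensorInner_reverse (v w : List E) :
    tensorInner v.reverse w.reverse = tensorInner v w := by
  have hnil : ∀ (l : List E) (a : E), tensorInner [] (l ++ [a]) = 0 ∧ tensorInner (l ++ [a]) [] = 0 :=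
    fun l a => by cases l <;> simp [tensorInner]
  induction v generalizing w with
  | nil => cases w <;> simp [tensorInner, hnil]
  | cons a v ih =>
    cases w with
    | nil => simp [tensorInner, hnil]
    | cons b w =>
      rw [List.reverse_cons, List.reverse_cons, tensorInner_append_singleton, ih, tensorInner]

theorem secondQuantization_vacuum (V : IsometricRep ℂ E) (t : ℝ) :
    secondQuantization V t (vacuum E) = vacuum E := by
  rw [vacuum, secondQuantization_tensor, List.map_nil]

/-- The weak limit is the projection onto `ℂΩ`. On simple tensors of positive degree the first
factor of the coefficient tends to `0` while the product of the others stays bounded. -/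
theorem tendsto_inner_secondQuantization {V : IsometricRep ℂ E} {l : Filter ℝ}
    (hV : ∀ x y, Tendsto (fun t => inner ℂ x (V t y)) l (𝓝 0)) (u v : FockSpace E) :
    Tendsto (fun t => inner ℂ u (secondQuantization V t v)) l
      (𝓝 (inner ℂ u (vacuum E) * inner ℂ (vacuum E) v)) := by
  have key := tendsto_inner_of_dense_span (l := l) (fun t => secondQuantization V t)
    ((innerSL ℂ (vacuum E)).smulRight (vacuum E)) dense_span_range_tensor ?_ u v
  · simpa [inner_smul_right, mul_comm] using key
  rintro _ ⟨v, rfl⟩ _ ⟨w, rfl⟩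
  simp only [ContinuousLinearMap.smulRight_apply, innerSL_apply_apply, inner_smul_right,
    secondQuantization_tensor, inner_tensor, vacuum]
  cases v with
  | nil => cases w <;> simp [tensorInner, tendsto_const_nhds]
  | cons a v =>
    cases w with
    | nil => simp [tensorInner, tendsto_const_nhds]
    | cons b w =>
      simp only [List.map_cons, tensorInner, mul_zero]
      have hbdd : ∀ t, ‖tensorInner v (w.map (V t))‖ ≤ ‖tensor v‖ * ‖tensor w‖ := by
        intro t
        rw [← inner_tensor, ← secondQuantization_tensor]
        exact (norm_inner_le_norm _ _).trans_eq (by rw [LinearIsometry.norm_map])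
      refine squeeze_zero_norm (fun t => ?_)
        (by simpa using ((hV a b).norm.mul_const (‖tensor v‖ * ‖tensor w‖)))
      rw [norm_mul]
      exact mul_le_mul_of_nonneg_left (hbdd t) (norm_nonneg _)

end Tensor

/-! ### Faithfulness, modular group and mixing for the free Araki–Woods algebra -/

section FreeArakiWoods

variable {H : Type*} [NormedAddCommGroup H] [InnerProductSpace ℝ H] (U : IsometricRep ℝ H)

theorem star_mem_range_semicircular : ∀ g ∈ Set.range fun x : H => semicircular (realInclusion U x),
    star g ∈ Set.range fun x : H => semicircular (realInclusion U x) := by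
  rintro _ ⟨x, rfl⟩
  exact ⟨x, (star_semicircular _).symm⟩

theorem semicircular_mem (x : H) :
    semicircular (realInclusion U x) ∈ (freeArakiWoods U).toStarSubalgebra := by
  change _ ∈ StarSubalgebra.centralizer ℂ _
  rw [StarSubalgebra.mem_centralizer_iff]
  have key : ∀ g ∈ StarSubalgebra.centralizer ℂ
      (Set.range fun x : H => semicircular (realInclusion U x)),
      g * semicircular (realInclusion U x) = semicircular (realInclusion U x) * g := by
    intro g hg
    rw [StarSubalgebra.mem_centralizer_iff] at hg
    exact (hg _ ⟨x, rfl⟩).1.symm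
  exact fun g hg => ⟨key g hg, key _ (star_mem hg)⟩

/-- The linear span of the Wick words in vectors of `H_ℝ`. -/
noncomputable def wickSpan :
    Submodule ℂ (FockSpace (OneParticle U) →L[ℂ] FockSpace (OneParticle U)) :=
  Submodule.span ℂ (Set.range fun v : List H => wickWord (v.map (realInclusion U)))

theorem wickWord_mem_wickSpan (v : List H) : wickWord (v.map (realInclusion U)) ∈ wickSpan U :=
  Submodule.subset_span ⟨v, rfl⟩

theorem semicircular_mul_mem_wickSpan :
    ∀ g ∈ Set.range fun x : H => semicircular (realInclusion U x),
    ∀ a ∈ wickSpan U, g * a ∈ wickSpan U := by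
  rintro _ ⟨x, rfl⟩ a ha
  induction ha using Submodule.span_induction with
  | mem a ha =>
    obtain ⟨v, rfl⟩ := ha
    beta_reduce
    rw [semicircular_mul_wickWord]
    refine Submodule.smul_mem _ _ (add_mem (wickWord_mem_wickSpan U (x :: v)) ?_)
    cases v with
    | nil => exact zero_mem _
    | cons y v => exact Submodule.smul_mem _ _ (wickWord_mem_wickSpan U v)
  | zero => rw [mul_zero]; exact zero_mem _
  | add a b _ _ ha hb => rw [mul_add]; exact add_mem ha hb
  | smul c a _ ha => rw [mul_smul_comm]; exact Submodule.smul_mem _ _ ha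

theorem quasiFreeState_apply (x : (freeArakiWoods U).toStarSubalgebra) : quasiFreeState U x =
    inner ℂ (vacuum (OneParticle U)) ((x : FockSpace (OneParticle U) →L[ℂ] FockSpace (OneParticle U))
      (vacuum (OneParticle U))) := rfl

theorem freeModularGroup_apply (t : ℝ) (x : (freeArakiWoods U).toStarSubalgebra)
    (f : FockSpace (OneParticle U)) :
    ((freeModularGroup U t x : (freeArakiWoods U).toStarSubalgebra) :
      FockSpace (OneParticle U) →L[ℂ] FockSpace (OneParticle U)) f =
    secondQuantization (oneParticleRep U) (-t)
      ((x : FockSpace (OneParticle U) →L[ℂ] FockSpace (OneParticle U))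
        (secondQuantization (oneParticleRep U) t f)) := by
  change secondQuantization (oneParticleRep U) (-t)
    ((x : FockSpace (OneParticle U) →L[ℂ] FockSpace (OneParticle U))
      (secondQuantization (oneParticleRep U) (- -t) f)) = _
  rw [neg_neg]

/-- `σ_t` is conjugation by `𝓕(U_{-t})`; the outer factor is absorbed by the invariant vacuum and
the inner one, `𝓕(U_t)`, remains. -/
theorem quasiFreeState_freeModularGroup_mul (t : ℝ) (x y : (freeArakiWoods U).toStarSubalgebra) :
    quasiFreeState U (freeModularGroup U t x * y) =
      inner ℂ (star (x : FockSpace (OneParticle U) →L[ℂ] FockSpace (OneParticle U))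
        (vacuum (OneParticle U))) (secondQuantization (oneParticleRep U) t
        ((y : FockSpace (OneParticle U) →L[ℂ] FockSpace (OneParticle U))
          (vacuum (OneParticle U)))) := by
  rw [quasiFreeState_apply, ContinuousLinearMap.star_eq_adjoint,
    ContinuousLinearMap.adjoint_inner_left]
  change inner ℂ (vacuum (OneParticle U)) (((freeModularGroup U t x :
    (freeArakiWoods U).toStarSubalgebra) : FockSpace (OneParticle U) →L[ℂ] FockSpace (OneParticle U))
    ((y : FockSpace (OneParticle U) →L[ℂ] FockSpace (OneParticle U)) (vacuum (OneParticle U)))) = _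
  rw [freeModularGroup_apply, ← IsometricRep.inner_apply_left, secondQuantization_vacuum]

theorem quasiFreeState_mul_freeModularGroup (t : ℝ) (x y : (freeArakiWoods U).toStarSubalgebra) :
    quasiFreeState U (y * freeModularGroup U t x) =
      inner ℂ (secondQuantization (oneParticleRep U) t
        (star (y : FockSpace (OneParticle U) →L[ℂ] FockSpace (OneParticle U))
          (vacuum (OneParticle U))))
        ((x : FockSpace (OneParticle U) →L[ℂ] FockSpace (OneParticle U))
          (vacuum (OneParticle U))) := by
  rw [IsometricRep.inner_apply_left, quasiFreeState_apply, ContinuousLinearMap.star_eq_adjoint,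
    ContinuousLinearMap.adjoint_inner_left]
  change inner ℂ (vacuum (OneParticle U)) ((y : FockSpace (OneParticle U) →L[ℂ]
    FockSpace (OneParticle U)) (((freeModularGroup U t x : (freeArakiWoods U).toStarSubalgebra) :
      FockSpace (OneParticle U) →L[ℂ] FockSpace (OneParticle U)) (vacuum (OneParticle U)))) = _
  rw [freeModularGroup_apply, secondQuantization_vacuum]

variable [CompleteSpace H]

/-- `φ_U(x^* x) = ‖xΩ‖²`, and `Ω` is separating because the operators `r(a) + r(b)^*` of commutant
pairs commute with the generators, hence with `x`. -/
theorem isFaithfulState_quasiFreeState :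
    IsFaithfulState (freeArakiWoods U) (quasiFreeState U) := by
  intro x hx
  have h0 : (x : FockSpace (OneParticle U) →L[ℂ] FockSpace (OneParticle U))
      (vacuum (OneParticle U)) = 0 := by
    rw [← inner_self_eq_zero (𝕜 := ℂ), ← ContinuousLinearMap.adjoint_inner_right]
    exact hx
  refine Subtype.ext (eq_zero_of_apply_vacuum_eq_zero (dense_setOf_isCommutantPair U)
    (fun a b hab => ?_) h0)
  refine mul_comm_of_mem_generated (star_mem_range_semicircular U) x.2 ?_
  rintro _ ⟨y, rfl⟩
  simp only [semicircular, smul_mul_assoc, mul_smul_comm,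
    commute_rightCreation_add_star (hab y)]

/-- Both boundary values are products over the letters, so the product of the one-particle KMS
functions works; tensors of different degrees need only the constant `0`. -/
theorem exists_isStripAnalytic_tensorInner (v w : List H) : ∃ F : ℂ → ℂ, IsStripAnalytic 0 1 F ∧
    ∀ t : ℝ, F t = tensorInner (v.map (realInclusion U))
        ((w.map (realInclusion U)).map (oneParticleRep U t)) ∧
      F (t + I) = tensorInner ((w.map (realInclusion U)).map (oneParticleRep U t))
        (v.map (realInclusion U)) := by
  induction v generalizing w with
  | nil =>
    cases w with
    | nil => exact ⟨_, .const 0 1 1, by simp [tensorInner]⟩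
    | cons b w => exact ⟨_, .const 0 1 0, by simp [tensorInner]⟩
  | cons a v ih =>
    cases w with
    | nil => exact ⟨_, .const 0 1 0, by simp [tensorInner]⟩
    | cons b w =>
      obtain ⟨f, hf, hf'⟩ := exists_isStripAnalytic_inner_realInclusion U a b
      obtain ⟨F, hF, hF'⟩ := ih w
      refine ⟨_, hf.mul hF, fun t => ⟨?_, ?_⟩⟩
      · simp only [(hf' t).1, (hF' t).1, List.map_cons, tensorInner]
      · simp only [(hf' t).2, (hF' t).2, List.map_cons, tensorInner]

theorem satisfiesKMS_wickWord (v w : List H) :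
    SatisfiesKMS (secondQuantization (oneParticleRep U)) (vacuum (OneParticle U))
      (wickWord (v.map (realInclusion U))) (wickWord (w.map (realInclusion U))) := by
  -- The adjoint of the first word reverses `v`. On the upper line it is `w` that comes out
  -- reversed, and reversing both arguments reconciles the two.
  obtain ⟨F, hF, hF'⟩ := exists_isStripAnalytic_tensorInner U v.reverse w
  refine ⟨F, hF, fun t => ⟨?_, ?_⟩⟩
  · rw [(hF' t).1, star_wickWord, wickWord_vacuum, wickWord_vacuum, secondQuantization_tensor,
      inner_tensor, List.map_reverse]
  · rw [(hF' t).2, star_wickWord, wickWord_vacuum, wickWord_vacuum, secondQuantization_tensor,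
      inner_tensor, ← tensorInner_reverse, List.map_reverse, List.map_reverse, List.reverse_reverse]

theorem satisfiesKMS_of_mem {x y : FockSpace (OneParticle U) →L[ℂ] FockSpace (OneParticle U)}
    (hx : x ∈ (freeArakiWoods U).toStarSubalgebra) (hy : y ∈ (freeArakiWoods U).toStarSubalgebra) :
    SatisfiesKMS (secondQuantization (oneParticleRep U)) (vacuum (OneParticle U)) x y := by
  obtain ⟨p, hp, hp1, hp2⟩ := exists_seq_tendsto_of_mem_generated (star_mem_range_semicircular U)
    (wickWord_mem_wickSpan U []) (semicircular_mul_mem_wickSpan U) hx (vacuum (OneParticle U))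
  obtain ⟨q, hq, hq1, hq2⟩ := exists_seq_tendsto_of_mem_generated (star_mem_range_semicircular U)
    (wickWord_mem_wickSpan U []) (semicircular_mul_mem_wickSpan U) hy (vacuum (OneParticle U))
  refine SatisfiesKMS.of_tendsto (fun n => SatisfiesKMS.of_mem_span ?_ (hp n) (hq n)) hp1 hp2 hq1 hq2
  rintro _ ⟨v, rfl⟩ _ ⟨w, rfl⟩
  exact satisfiesKMS_wickWord U v w

theorem isModularGroup_freeModularGroup :
    IsModularGroup (freeArakiWoods U) (quasiFreeState U) (freeModularGroup U) where
  add_apply s t x := by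
    refine Subtype.ext (ContinuousLinearMap.ext fun f => ?_)
    rw [freeModularGroup_apply, freeModularGroup_apply, freeModularGroup_apply,
      ← IsometricRep.add_apply, ← IsometricRep.add_apply, ← neg_add, add_comm t s]
  continuous x v := by
    simp only [freeModularGroup_apply]
    exact IsometricRep.continuous_apply _ continuous_neg
      ((ContinuousLinearMap.continuous _).comp (IsometricRep.continuous' _ v))
  invariant t x := by
    rw [quasiFreeState_apply, quasiFreeState_apply, freeModularGroup_apply,
      ← IsometricRep.inner_apply_left, secondQuantization_vacuum]
  kms x y := by
    obtain ⟨F, hF, hF'⟩ := satisfiesKMS_of_mem U x.2 y.2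
    refine ⟨F, hF, fun t => ?_⟩
    rw [quasiFreeState_freeModularGroup_mul, quasiFreeState_mul_freeModularGroup]
    exact hF' t

/-- The weak limit of `𝓕(U_t)` gives `φ_U(σ_t(x) y) → ⟨x^*Ω, Ω⟩ φ_U(y)`, and the last factor is `0`.
-/
theorem isStateMixing_of_isMixing (hU : U.IsMixing) :
    IsStateMixing (freeArakiWoods U) (quasiFreeState U) (freeModularGroup U) := by
  intro x y _ hy
  simp only [quasiFreeState_freeModularGroup_mul]
  have := tendsto_inner_secondQuantization (tendsto_inner_oneParticleRep U hU)
    (star (x : FockSpace (OneParticle U) →L[ℂ] FockSpace (OneParticle U)) (vacuum (OneParticle U)))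
    ((y : FockSpace (OneParticle U) →L[ℂ] FockSpace (OneParticle U)) (vacuum (OneParticle U)))
  rw [← quasiFreeState_apply, hy, mul_zero] at this
  exact this

theorem isMixing_of_isStateMixing
    (h : IsStateMixing (freeArakiWoods U) (quasiFreeState U) (freeModularGroup U)) :
    U.IsMixing := by
  refine isMixing_of_oneParticle U fun x y => ?_
  have h0 : ∀ z : H, quasiFreeState U ⟨_, semicircular_mem U z⟩ = 0 := fun z => by
    rw [quasiFreeState_apply, semicircular_vacuum, inner_smul_right, vacuum, inner_tensor]
    simp [tensorInner]
  -- The factor `4` cancels the two halves in `s(x)Ω = x / 2` and `s(y)Ω = y / 2`.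
  have := (h _ _ (h0 x) (h0 y)).const_mul 4
  rw [mul_zero] at this
  refine this.congr fun t => ?_
  rw [quasiFreeState_freeModularGroup_mul]
  simp only [star_semicircular, semicircular_vacuum, map_smul, inner_smul_left, inner_smul_right,
    secondQuantization_tensor, inner_tensor, List.map_cons, List.map_nil, tensorInner]
  rw [map_inv₀, map_ofNat]
  ring

end FreeArakiWoods

end FreeArakiWoods

theorem mainTheorem5 {H : Type*} [NormedAddCommGroup H] [InnerProductSpace ℝ H] [CompleteSpace H]
    (U : FreeArakiWoods.IsometricRep ℝ H) :
    FreeArakiWoods.IsFaithfulState (FreeArakiWoods.freeArakiWoods U)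
        (FreeArakiWoods.quasiFreeState U) ∧
      FreeArakiWoods.IsModularGroup (FreeArakiWoods.freeArakiWoods U)
        (FreeArakiWoods.quasiFreeState U) (FreeArakiWoods.freeModularGroup U) ∧
      (U.IsMixing ↔
        FreeArakiWoods.IsStateMixing (FreeArakiWoods.freeArakiWoods U)
          (FreeArakiWoods.quasiFreeState U) (FreeArakiWoods.freeModularGroup U)) :=
  ⟨FreeArakiWoods.isFaithfulState_quasiFreeState U,
    FreeArakiWoods.isModularGroup_freeModularGroup U,
    FreeArakiWoods.isStateMixing_of_isMixing U, FreeArakiWoods.isMixing_of_isStateMixing U⟩
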